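/- **Setting.** Let $S\subset\mathbb C^2$ be an open neighbourhood of $0$, with coordinates $(s,t)$, stable under complex conjugation (a coordinate neighbourhood of a real point $0$ of a smooth real surface). A holomorphic function, map or matrix on $S$ is called *real* if it commutes with complex conjugation. A *real conic bundle* $f:Y\to S$ is given by a real holomorphic family $Q_{(s,t)}(x,y,z)$ of quadratic forms, nonzero for every $(s,t)\in S$: $Y=(Q_{(s,t)}(x,y,z)=0)\subset\mathbb P^2_{x:y:z}\times S$ and $f$ is the second projection; each fibre is a smooth conic, a pair of lines or a double line. An $f$-equivariant action of $\mathbb Z_m$ on $Y\to S$ is an action on $S$ by real biholomorphic maps $\sigma_k$ together with a compatible action on the $\mathbb P^2$-bundle $\mathbb P^2\times S$ of the form $([v],p)\mapsto([A_k(p)v],\sigma_k(p))$, with $A_k$ a real holomorphic family of invertible $3\times 3$ matrices, that maps each conic $f^{-1}(p)$ to the conic $f^{-1}(\sigma_k(p))$. Let $R_{a,m}(u,v)$ denote the 2-dimensional real representation of $\mathbb Z_m$ in which the chosen generator acts by rotation by $2\pi a/m$, that is, $u\mapsto \cos(2\pi a/m)u+\sin(2\pi a/m)v$, $v\mapsto-\sin(2\pi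 a/m)u+\cos(2\pi a/m)v$, and let $\mathbf 1$ be the trivial 1-dimensional representation. **Theorem.** Let $m\ge 2$ and let $f:Y\to S$ be a real conic bundle with an $f$-equivariant $\mathbb Z_m$-action fixing $0\in S$. Assume that $Y$ has only isolated singularities, that the central fibre $f^{-1}(0)$ has a real point, and that every $k\in\mathbb Z_m$ with $k\ne 1$ has only isolated and nonreal fixed points on the set of complex points of $Y$. Then, for a suitable choice of the generator of $\mathbb Z_m$ and after shrinking $S$ to a smaller invariant neighbourhood of $0$, $f:Y\to S$ is $\mathbb Z_m$-equivariantly and real analytically equivalent (by a real biholomorphic change of the coordinates $(s,t)$ fixing $0$ and a real holomorphic, fibrewise linear change of the homogeneous coordinates $(x:y:z)$) to one of the following normal forms: 1. $Y=(z^2-x^2-y^2+h_1(x,y,z,s,t)=0)$, where $\mathbb Z_m$ acts on the base by $R_{b,m}(s,t)$ for some $b$ with $(b,m)=1$; or 2. $m$ is odd, $Y=(z^2+sx^2+2txy-sy^2+h_2(x,y,z,s,t)=0)$, and $\mathbb Z_m$ acts on the base by $R_{2,m}(s,t)$ (that is, $b=2$). In both cases $\mathbb Z_m$ acts on $\mathbb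 P^2_{x:y:z}$ through the representation $\mathbf 1(z)\oplus R_{1,m}(x,y)$, and $h_i$ is a quadratic form in $x,y,z$ whose coefficients are real holomorphic functions of $(s,t)$ near $0$ lying in $(s,t)^i$. -/

import Mathlib

open Filter Topology Asymptotics

/-- Local complex coordinates `(s, t)` on the base. Complex conjugation is `star`. -/
abbrev BaseC := Fin 2 → ℂ

/-- Homogeneous coordinates `(x, y, z)` on the projective plane. -/
abbrev FibC := Fin 3 → ℂ

/-- The value at `v = (x, y, z)` of the quadratic form with matrix `M`. -/
def quadVal (M : Matrix (Fin 3) (Fin 3) ℂ) (v : FibC) : ℂ := v ⬝ᵥ M.mulVec v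

/-- All entries of the matrix-valued function `M` are complex analytic on the open set `U`. -/
def MatAnalyticOn (M : BaseC → Matrix (Fin 3) (Fin 3) ℂ) (U : Set BaseC) : Prop :=
  ∀ i j, AnalyticOnNhd ℂ (fun s => M s i j) U

/-- The matrix-valued function `M` is real, i.e. it commutes with complex conjugation on `U`
(equivalently, its power series at real points have real coefficients). -/
def MatRealOn (M : BaseC → Matrix (Fin 3) (Fin 3) ℂ) (U : Set BaseC) : Prop :=
  ∀ s ∈ U, M (star s) = (M s).map star

/-- A real conic bundle over a neighbourhood `S` of the real point `0` of a smooth real surface, in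
local coordinates: `S` is a conjugation-invariant open neighbourhood of `0` in `ℂ²`, and the total
space `Y ⊆ ℙ² × S` is given by one equation, a nowhere vanishing quadratic form in `(x, y, z)`
whose coefficients are real analytic functions of `(s, t)`. The bundle map is the second
projection. Every fibre is a smooth conic, a pair of lines or a double line. -/
structure RealConicBundle where
  /-- the base -/
  S : Set BaseC
  isOpen_S : IsOpen S
  zero_mem : (0 : BaseC) ∈ S
  star_mem : ∀ s ∈ S, star s ∈ S
  /-- the symmetric matrix of the equation of the fibre over `s` -/
  Q : BaseC → Matrix (Fin 3) (Fin 3) ℂ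
  analytic : MatAnalyticOn Q S
  real : MatRealOn Q S
  symm : ∀ s ∈ S, (Q s).IsSymm
  ne_zero : ∀ s ∈ S, Q s ≠ 0

namespace RealConicBundle

/-- The equation of `Y` as a function of `((x, y, z), (s, t))`. -/
def eqn (X : RealConicBundle) (p : FibC × BaseC) : ℂ := quadVal (X.Q p.2) p.1

/-- The complex points of `Y ⊆ ℙ² × S`, in homogeneous coordinates: `(v, s)` stands for the point
`([v], s)`. -/
def total (X : RealConicBundle) : Set (FibC × BaseC) :=
  {p | p.1 ≠ 0 ∧ p.2 ∈ X.S ∧ X.eqn p = 0}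

/-- The singular points of `Y`, by the Jacobian criterion. -/
def sing (X : RealConicBundle) : Set (FibC × BaseC) :=
  {p | p ∈ X.total ∧ fderiv ℂ X.eqn p = 0}

end RealConicBundle

/-- The point `([v], s)` of `ℙ² × ℂ²` is real, i.e. fixed by complex conjugation. -/
def IsRealPt (p : FibC × BaseC) : Prop :=
  star p.2 = p.2 ∧ ∃ c : ℂ, star p.1 = c • p.1

/-- `Z` is a set of points `([v], s)` of `ℙ² × ℂ²` in homogeneous coordinates. All its points are
isolated: near `([v], s) ∈ Z` there is no other point of `Z`. -/
def OnlyIsolatedPts (Z : Set (FibC × BaseC)) : Prop :=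
  ∀ p ∈ Z, ∃ U ∈ 𝓝 p, ∀ q ∈ U ∩ Z, q.2 = p.2 ∧ ∃ c : ℂ, q.1 = c • p.1

/-- An action of `ℤ/m` on a real conic bundle, compatible with the bundle map: `k` acts on the base
by `σ k`, and on `ℙ² × S` by `([v], s) ↦ ([A k s v], σ k s)`, where `σ k` and `A k` are real
analytic and `A k s` is invertible. Matrices matter only up to nonzero scalars, so this is an
action on the `ℙ²`-bundle, and no linear action on the rank 3 vector bundle is chosen. Each `k`
takes the conic `Y_s` to the conic `Y_{σ k s}`, hence `Y` to `Y`.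
(The ambient `ℙ²`-bundle of a conic bundle is the projectivization of the direct image of the
relative anticanonical sheaf, so automorphisms of `Y` over `S` are of this kind.) -/
structure ConicBundleAction (X : RealConicBundle) (m : ℕ) where
  σ : ZMod m → BaseC → BaseC
  A : ZMod m → BaseC → Matrix (Fin 3) (Fin 3) ℂ
  σ_mapsTo : ∀ k, Set.MapsTo (σ k) X.S X.S
  σ_analytic : ∀ k, AnalyticOnNhd ℂ (σ k) X.S
  σ_real : ∀ k, ∀ s ∈ X.S, σ k (star s) = star (σ k s)
  σ_zero : ∀ s ∈ X.S, σ 0 s = s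
  σ_add : ∀ k l, ∀ s ∈ X.S, σ (k + l) s = σ k (σ l s)
  A_analytic : ∀ k, MatAnalyticOn (A k) X.S
  A_real : ∀ k, MatRealOn (A k) X.S
  A_det : ∀ k, ∀ s ∈ X.S, (A k s).det ≠ 0
  A_zero : ∀ s ∈ X.S, ∃ c : ℂ, c ≠ 0 ∧ A 0 s = c • (1 : Matrix (Fin 3) (Fin 3) ℂ)
  A_add : ∀ k l, ∀ s ∈ X.S, ∃ c : ℂ, c ≠ 0 ∧ A (k + l) s = c • (A k (σ l s) * A l s)
  preserves : ∀ k, ∀ s ∈ X.S, ∃ c : ℂ, c ≠ 0 ∧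
    ∀ v, quadVal (X.Q (σ k s)) ((A k s).mulVec v) = c * quadVal (X.Q s) v

/-- The fixed points of `k` on the complex points of `Y`. -/
def ConicBundleAction.fixedPts {X : RealConicBundle} {m : ℕ} (α : ConicBundleAction X m)
    (k : ZMod m) : Set (FibC × BaseC) :=
  {p | p ∈ X.total ∧ α.σ k p.2 = p.2 ∧ ∃ c : ℂ, (α.A k p.2).mulVec p.1 = c • p.1}

noncomputable section

/-- The matrix of the `j`-th power of the generator in `𝟏(z) ⊕ R_{1,m}(x, y)`,
in the coordinates `(x, y, z)`. -/
def fibRot (m j : ℕ) : Matrix (Fin 3) (Fin 3) ℂ :=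
  let θ : ℝ := 2 * Real.pi * j / m
  !![(Real.cos θ : ℂ), (Real.sin θ : ℂ), 0;
     -(Real.sin θ : ℂ), (Real.cos θ : ℂ), 0;
     0, 0, 1]

/-- The matrix of the `j`-th power of the generator in `R_{b,m}(s, t)`. -/
def baseRot (m b j : ℕ) : Matrix (Fin 2) (Fin 2) ℂ :=
  let θ : ℝ := 2 * Real.pi * b * j / m
  !![(Real.cos θ : ℂ), (Real.sin θ : ℂ);
     -(Real.sin θ : ℂ), (Real.cos θ : ℂ)]

/-- The quadratic form `z² - x² - y²`. -/
def normalForm₁ (_ : BaseC) (v : FibC) : ℂ := v 2 ^ 2 - v 0 ^ 2 - v 1 ^ 2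

/-- The quadratic form `z² + s x² + 2 t x y - s y²`. -/
def normalForm₂ (w : BaseC) (v : FibC) : ℂ :=
  v 2 ^ 2 + w 0 * v 0 ^ 2 + 2 * w 1 * v 0 * v 1 - w 0 * v 1 ^ 2

end

/-- `X` with its `ℤ/m`-action is, near the central fibre, equivariantly and real analytically
equivalent to the conic bundle `N + h = 0`, where `h` is a quadratic form in `(x, y, z)` whose
coefficients are real analytic functions of `(s, t)` that vanish at `0` to order at least `i`
(i.e. lie in `(s, t)^i`), and where the generator `g` of `ℤ/m` acts by `𝟏(z) ⊕ R_{1,m}(x, y)` on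
the fibre coordinates and by `R_{b,m}(s, t)` on the base.

The equivalence is `([v], s) ↦ ([B s v], ψ s)` with `ψ` a real biholomorphic map of neighbourhoods
of `0` and `B` real analytic with invertible values. -/
def EquivariantlyEquivalent {X : RealConicBundle} {m : ℕ} (α : ConicBundleAction X m)
    (g : ZMod m) (b : ℕ) (N : BaseC → FibC → ℂ) (i : ℕ) : Prop :=
  ∃ (ψ : OpenPartialHomeomorph BaseC BaseC) (B H : BaseC → Matrix (Fin 3) (Fin 3) ℂ),
    -- `ψ` is a real biholomorphic map defined on an invariant neighbourhood of `0`
    ((0 : BaseC) ∈ ψ.source ∧ ψ 0 = 0 ∧ ψ.source ⊆ X.S ∧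
      (∀ s ∈ ψ.source, star s ∈ ψ.source) ∧
      (∀ k, Set.MapsTo (α.σ k) ψ.source ψ.source) ∧
      AnalyticOnNhd ℂ ψ ψ.source ∧ AnalyticOnNhd ℂ ψ.symm ψ.target ∧
      (∀ s ∈ ψ.source, ψ (star s) = star (ψ s))) ∧
    -- `B` is a real analytic change of the fibre coordinates
    (MatAnalyticOn B ψ.source ∧ MatRealOn B ψ.source ∧ ∀ s ∈ ψ.source, (B s).det ≠ 0) ∧
    -- `h` is real analytic of order at least `i`
    (MatAnalyticOn H ψ.target ∧ MatRealOn H ψ.target ∧ (∀ w ∈ ψ.target, (H w).IsSymm) ∧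
      ∀ j k, (fun w => H w j k) =O[𝓝 0] fun w => ‖w‖ ^ i) ∧
    -- the equation of `X` becomes `N + h = 0`
    (∀ s ∈ ψ.source, ∃ c : ℂ, c ≠ 0 ∧ ∀ v,
      N (ψ s) ((B s).mulVec v) + quadVal (H (ψ s)) ((B s).mulVec v) = c * quadVal (X.Q s) v) ∧
    -- the action becomes the linear one
    (∀ j : ℕ, ∀ s ∈ ψ.source,
      ψ (α.σ (j * g) s) = (baseRot m b j).mulVec (ψ s) ∧
      ∃ c : ℂ, c ≠ 0 ∧ B (α.σ (j * g) s) * α.A (j * g) s = c • (fibRot m j * B s))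

/-!
Averaging over the group linearizes the action on the fibres: the generator acts by `𝟏 ⊕ R₁`. The
point `(0 : 0 : 1)` is then a real fixed point, hence not on the central fibre, so completing the
square brings the equation to the form `z² + a x² + 2 b x y + c y² = 0`. If an element other than
the neutral one had a fixed vector in the tangent space of the base, it would fix the points of a
curve in the base, and its fixed points on `Y` would not be isolated. So the base action is a
faithful representation in the plane without fixed vectors. Since fixed points are never real, the
binary form `a x² + 2 b x y + c y²` at the origin is either negative definite or zero with `m` odd.

* If it is negative definite, the square root of its negative commutes with the rotations, and using
  it as a further change of coordinates makes the central fibre `z² - x² - y² = 0`.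
* If it is zero, then `a`, `b`, `c` do not all have differential zero, as the singularities are
  isolated. Rotation by an angle `θ` acts on the harmonic part `((a - c) / 2, b)` as rotation by
  `2θ` and fixes the trace `a + c`, which is an invariant function on the base and therefore
  vanishes to second order. So the differential of the harmonic part is not zero, and as it commutes
  with the rotations it is invertible: the harmonic part is the required coordinate system.
-/

open scoped Matrix

section Complexify

variable {n : Type*} [Fintype n] [DecidableEq n]

/-- The extension of scalars of a real square matrix to `ℂ`. -/
def complexify : Matrix n n ℝ →+* Matrix n n ℂ := Complex.ofRealHom.mapMatrix

lemma complexify_apply (M : Matrix n n ℝ) (i j : n) : complexify M i j = M i j := rfl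

lemma complexify_injective : Function.Injective (complexify (n := n)) :=
  Matrix.map_injective Complex.ofReal_injective

lemma det_complexify (M : Matrix n n ℝ) : (complexify M).det = M.det :=
  (RingHom.map_det Complex.ofRealHom M).symm

end Complexify

section RealGerms

variable {E F : Type*} [NormedAddCommGroup E] [NormedSpace ℂ E] [StarAddMonoid E]
  [NormedAddCommGroup F] [NormedSpace ℂ F]

/-- A real analytic germ at the origin: `f` is complex analytic at `0` and commutes with complex
conjugation near `0`. Germs are encoded by arbitrary functions, so that equalities between them
hold only `∀ᶠ s in 𝓝 0`. -/
def IsRealGerm [Star F] (f : E → F) : Prop :=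
  AnalyticAt ℂ f 0 ∧ ∀ᶠ s in 𝓝 (0 : E), f (star s) = star (f s)

/-- A matrix-valued function all of whose entries are real analytic germs. Reality is required
entrywise because `star` is the conjugate transpose on matrices. -/
def IsRealMatrixGerm {ι κ : Type*} (M : E → Matrix ι κ ℂ) : Prop :=
  ∀ i j, IsRealGerm fun s => M s i j

namespace IsRealGerm

lemma const [Star F] {c : F} (hc : star c = c) : IsRealGerm fun _ : E => c :=
  ⟨analyticAt_const, .of_forall fun _ => hc.symm⟩

lemma ofReal (r : ℝ) : IsRealGerm fun _ : E => (r : ℂ) := const (Complex.conj_ofReal r)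

lemma tendsto_zero [Star F] {f : E → F} (hf : IsRealGerm f) (h0 : f 0 = 0) :
    Tendsto f (𝓝 0) (𝓝 0) := by
  simpa only [h0] using hf.1.continuousAt.tendsto

lemma comp [Star F] {G : Type*} [NormedAddCommGroup G] [NormedSpace ℂ G] [StarAddMonoid G]
    {f : G → F} {φ : E → G} (hf : IsRealGerm f) (hφ : IsRealGerm φ) (h0 : φ 0 = 0) :
    IsRealGerm fun s => f (φ s) := by
  refine ⟨AnalyticAt.fun_comp (h0 ▸ hf.1) hφ.1, ?_⟩
  filter_upwards [hφ.2, (hφ.tendsto_zero h0).eventually hf.2] with s h₁ h₂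
  rw [h₁, h₂]

lemma neg [StarAddMonoid F] {f : E → F} (hf : IsRealGerm f) : IsRealGerm fun s => -f s :=
  ⟨hf.1.neg, by filter_upwards [hf.2] with s hs; rw [hs, star_neg]⟩

lemma add [StarAddMonoid F] {f g : E → F} (hf : IsRealGerm f) (hg : IsRealGerm g) :
    IsRealGerm fun s => f s + g s :=
  ⟨hf.1.add hg.1, by filter_upwards [hf.2, hg.2] with s h₁ h₂; rw [h₁, h₂, star_add]⟩

lemma sub [StarAddMonoid F] {f g : E → F} (hf : IsRealGerm f) (hg : IsRealGerm g) :
    IsRealGerm fun s => f s - g s :=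
  ⟨hf.1.sub hg.1, by filter_upwards [hf.2, hg.2] with s h₁ h₂; rw [h₁, h₂, star_sub]⟩

lemma sum [StarAddMonoid F] {ι : Type*} (t : Finset ι) {f : ι → E → F}
    (h : ∀ i ∈ t, IsRealGerm (f i)) : IsRealGerm fun s => ∑ i ∈ t, f i s :=
  ⟨Finset.analyticAt_fun_sum _ fun i hi => (h i hi).1, by
    filter_upwards [(Finset.eventually_all t).2 fun i hi => (h i hi).2] with s hs
    rw [star_sum, Finset.sum_congr rfl hs]⟩

lemma pi_iff {ι : Type*} [Fintype ι] {φ : E → ι → ℂ} :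
    IsRealGerm φ ↔ ∀ i, IsRealGerm fun s => φ s i := by
  simp only [IsRealGerm, forall_and, ← eventually_all, funext_iff, Pi.star_apply]
  exact and_congr_left' (analyticAt_pi_iff (f := fun i s => φ s i))

variable {f g : E → ℂ}

lemma mul (hf : IsRealGerm f) (hg : IsRealGerm g) : IsRealGerm fun s => f s * g s :=
  ⟨hf.1.mul hg.1, by filter_upwards [hf.2, hg.2] with s h₁ h₂; rw [h₁, h₂, star_mul']⟩

lemma prod {ι : Type*} (t : Finset ι) {f : ι → E → ℂ} (h : ∀ i ∈ t, IsRealGerm (f i)) :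
    IsRealGerm fun s => ∏ i ∈ t, f i s :=
  ⟨Finset.analyticAt_fun_prod _ fun i hi => (h i hi).1, by
    filter_upwards [(Finset.eventually_all t).2 fun i hi => (h i hi).2] with s hs
    rw [star_prod, Finset.prod_congr rfl hs]⟩

lemma pow (hf : IsRealGerm f) (n : ℕ) : IsRealGerm fun s => f s ^ n :=
  ⟨hf.1.pow n, by filter_upwards [hf.2] with s hs; rw [hs, star_pow]⟩

lemma inv (hf : IsRealGerm f) (h0 : f 0 ≠ 0) : IsRealGerm fun s => (f s)⁻¹ :=
  ⟨hf.1.inv h0, by filter_upwards [hf.2] with s hs; rw [hs, star_inv₀]⟩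

lemma eventually_ne (hf : IsRealGerm f) (h0 : f 0 ≠ 0) : ∀ᶠ s in 𝓝 (0 : E), f s ≠ 0 :=
  hf.1.continuousAt.eventually_ne h0

lemma ofReal_re (hf : IsRealGerm f) : ((f 0).re : ℂ) = f 0 := by
  have h := hf.2.self_of_nhds
  rw [star_zero] at h
  exact Complex.conj_eq_iff_re.1 h.symm

lemma cpow_ofReal (hf : IsRealGerm f) (h0 : 0 < (f 0).re) (r : ℝ) :
    IsRealGerm fun s => f s ^ (r : ℂ) := by
  have hslit : f 0 ∈ Complex.slitPlane := Or.inl h0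
  refine ⟨hf.1.cpow analyticAt_const hslit, ?_⟩
  filter_upwards [hf.2, hf.1.continuousAt.eventually (Complex.isOpen_slitPlane.mem_nhds hslit)]
    with s hs hs'
  have h := Complex.conj_cpow (f s) r (Complex.slitPlane_arg_ne_pi hs')
  rw [Complex.conj_ofReal] at h
  rw [hs]
  exact h

lemma exists_pow_eq_of_pos (hf : IsRealGerm f) (h0 : 0 < (f 0).re) {n : ℕ} (hn : n ≠ 0) :
    ∃ u : E → ℂ, IsRealGerm u ∧ ∀ s, u s ^ n = f s :=
  ⟨_, hf.cpow_ofReal h0 (n : ℝ)⁻¹, fun s => by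
    push_cast
    exact Complex.cpow_nat_inv_pow _ hn⟩

lemma exists_pow_eq_of_odd (hf : IsRealGerm f) (h0 : f 0 ≠ 0) {n : ℕ} (hn : Odd n) :
    ∃ u : E → ℂ, IsRealGerm u ∧ ∀ s, u s ^ n = f s := by
  have hre : (f 0).re ≠ 0 := fun h => h0 (by rw [← hf.ofReal_re, h, Complex.ofReal_zero])
  rcases hre.lt_or_gt with hneg | hpos
  · obtain ⟨u, hu, hun⟩ := hf.neg.exists_pow_eq_of_pos (by simpa using hneg) hn.pos.ne'
    exact ⟨fun s => -u s, hu.neg, fun s => by rw [hn.neg_pow, hun, neg_neg]⟩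
  · exact hf.exists_pow_eq_of_pos hpos hn.pos.ne'

lemma eventually_eq_one_of_pow_eq_one (hf : IsRealGerm f) {n : ℕ} (hn : Odd n)
    (h : ∀ᶠ s in 𝓝 (0 : E), f s ^ n = 1) : ∀ᶠ s in 𝓝 (0 : E), f s = 1 := by
  have h0 : f 0 = 1 := by
    have hre : (f 0).re ^ n = 1 := by
      exact_mod_cast (congrArg (· ^ n) hf.ofReal_re).trans h.self_of_nhds
    have hre₁ : (f 0).re = 1 := hn.strictMono_pow.injective (hre.trans (one_pow n).symm)
    rw [← hf.ofReal_re, hre₁, Complex.ofReal_one]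
  have hgeom : ∀ᶠ s in 𝓝 (0 : E), ∑ i ∈ Finset.range n, f s ^ i ≠ 0 :=
    (sum (Finset.range n) fun i _ => hf.pow i).eventually_ne (by simp [h0, hn.pos.ne'])
  filter_upwards [h, hgeom] with s hs hs'
  exact sub_eq_zero.1
    ((mul_eq_zero.1 ((geom_sum_mul (f s) n).trans (by rw [hs, sub_self]))).resolve_left hs')

end IsRealGerm

namespace IsRealMatrixGerm

variable {ι κ τ : Type*}

lemma comp {G : Type*} [NormedAddCommGroup G] [NormedSpace ℂ G] [StarAddMonoid G]
    {M : G → Matrix ι κ ℂ} {φ : E → G} (hM : IsRealMatrixGerm M) (hφ : IsRealGerm φ)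
    (h0 : φ 0 = 0) : IsRealMatrixGerm fun s => M (φ s) :=
  fun i j => (hM i j).comp hφ h0

lemma smul {f : E → ℂ} {M : E → Matrix ι κ ℂ} (hf : IsRealGerm f) (hM : IsRealMatrixGerm M) :
    IsRealMatrixGerm fun s => f s • M s :=
  fun i j => hf.mul (hM i j)

lemma sum {β : Type*} (t : Finset β) {M : β → E → Matrix ι κ ℂ}
    (h : ∀ i ∈ t, IsRealMatrixGerm (M i)) : IsRealMatrixGerm fun s => ∑ i ∈ t, M i s :=
  fun i j => by
    simp only [Matrix.sum_apply]
    exact .sum t fun k hk => h k hk i j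

lemma transpose {M : E → Matrix ι κ ℂ} (hM : IsRealMatrixGerm M) :
    IsRealMatrixGerm fun s => (M s)ᵀ :=
  fun i j => hM j i

lemma eventually_star [Finite ι] [Finite κ] {M : E → Matrix ι κ ℂ} (hM : IsRealMatrixGerm M) :
    ∀ᶠ s in 𝓝 (0 : E), M (star s) = (M s).map star := by
  filter_upwards [eventually_all.2 fun i => eventually_all.2 fun j => (hM i j).2] with s hs
  exact Matrix.ext hs

variable [Fintype κ]

lemma mul {M : E → Matrix ι κ ℂ} {N : E → Matrix κ τ ℂ} (hM : IsRealMatrixGerm M)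
    (hN : IsRealMatrixGerm N) : IsRealMatrixGerm fun s => M s * N s :=
  fun i j => .sum _ fun k _ => (hM i k).mul (hN k j)

lemma mulVec [Fintype ι] {M : E → Matrix ι κ ℂ} {φ : E → κ → ℂ} (hM : IsRealMatrixGerm M)
    (hφ : IsRealGerm φ) : IsRealGerm fun s => M s *ᵥ φ s :=
  IsRealGerm.pi_iff.2 fun i => .sum _ fun k _ => (hM i k).mul (IsRealGerm.pi_iff.1 hφ k)

lemma star_mulVec_zero [Finite ι] {M : E → Matrix ι κ ℂ} (hM : IsRealMatrixGerm M) {v : κ → ℂ}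
    (hv : star v = v) : star (M 0 *ᵥ v) = M 0 *ᵥ v := by
  cases nonempty_fintype ι
  have h := (hM.mulVec (.const hv)).2.self_of_nhds
  rw [star_zero] at h
  exact h.symm

variable {M N : E → Matrix κ κ ℂ}

lemma trace (hM : IsRealMatrixGerm M) : IsRealGerm fun s => (M s).trace :=
  .sum _ fun i _ => hM i i

variable [DecidableEq κ]

lemma complexify (M : Matrix κ κ ℝ) : IsRealMatrixGerm fun _ : E => _root_.complexify M :=
  fun i j => .ofReal (M i j)

lemma exists_complexify_eq (hM : IsRealMatrixGerm M) :
    ∃ N : Matrix κ κ ℝ, _root_.complexify N = M 0 :=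
  ⟨(M 0).map Complex.re, Matrix.ext fun i j => (hM i j).ofReal_re⟩

lemma det (hM : IsRealMatrixGerm M) : IsRealGerm fun s => (M s).det := by
  simp only [Matrix.det_apply']
  exact .sum _ fun p _ => (IsRealGerm.const (by simp)).mul (.prod _ fun i _ => hM _ _)

lemma adjugate (hM : IsRealMatrixGerm M) : IsRealMatrixGerm fun s => (M s).adjugate :=
  fun i j => by
    simp only [Matrix.adjugate_apply]
    refine det fun k l => ?_
    by_cases hk : k = j
    · simp only [hk, Matrix.updateRow_self]
      exact .const (by simp [Pi.single_apply, apply_ite])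
    · simp only [Matrix.updateRow_ne hk]
      exact hM k l

lemma inv (hM : IsRealMatrixGerm M) (h0 : (M 0).det ≠ 0) : IsRealMatrixGerm fun s => (M s)⁻¹ := by
  simp only [Matrix.inv_def, Ring.inverse_eq_inv]
  exact smul (hM.det.inv h0) hM.adjugate

lemma eventually_det_ne_zero (hM : IsRealMatrixGerm M) (h0 : (M 0).det ≠ 0) :
    ∀ᶠ s in 𝓝 (0 : E), (M s).det ≠ 0 :=
  hM.det.eventually_ne h0

lemma exists_det_smul_eq_one (hκ : Odd (Fintype.card κ)) (hM : IsRealMatrixGerm M)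
    (h0 : (M 0).det ≠ 0) :
    ∃ u : E → ℂ, IsRealGerm u ∧ ∀ᶠ s in 𝓝 (0 : E), (u s • M s).det = 1 := by
  obtain ⟨u, hu, hu_pow⟩ := (hM.det.inv h0).exists_pow_eq_of_odd (inv_ne_zero h0) hκ
  refine ⟨u, hu, ?_⟩
  filter_upwards [hM.eventually_det_ne_zero h0] with s hs
  rw [Matrix.det_smul, hu_pow, inv_mul_cancel₀ hs]

/-- The ratio `c` is the germ `tr (M N⁻¹) / card κ`, and it is a root of unity of odd order. -/
lemma eventually_eq_of_proportional (hκ : Odd (Fintype.card κ)) (hM : IsRealMatrixGerm M)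
    (hN : IsRealMatrixGerm N) (hMdet : ∀ᶠ s in 𝓝 (0 : E), (M s).det = 1)
    (hNdet : ∀ᶠ s in 𝓝 (0 : E), (N s).det = 1)
    (h : ∀ᶠ s in 𝓝 (0 : E), ∃ c : ℂ, M s = c • N s) : ∀ᶠ s in 𝓝 (0 : E), M s = N s := by
  have hcard : (Fintype.card κ : ℂ) ≠ 0 := by exact_mod_cast hκ.pos.ne'
  set r : E → ℂ := fun s => (Fintype.card κ : ℂ)⁻¹ * (M s * (N s)⁻¹).trace
  have hr : IsRealGerm r :=
    (IsRealGerm.const (by simp)).mul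
      (hM.mul (hN.inv (by rw [hNdet.self_of_nhds]; exact one_ne_zero))).trace
  have hMN : ∀ᶠ s in 𝓝 (0 : E), M s = r s • N s := by
    filter_upwards [h, hNdet] with s ⟨c, hc⟩ hdet
    have hrc : r s = c := by
      simp only [r]
      rw [hc, Matrix.smul_mul, Matrix.mul_nonsing_inv _ (hdet ▸ isUnit_one), Matrix.trace_smul,
        Matrix.trace_one, smul_eq_mul]
      field_simp
    rw [hrc, hc]
  have hr_pow : ∀ᶠ s in 𝓝 (0 : E), r s ^ Fintype.card κ = 1 := by
    filter_upwards [hMN, hMdet, hNdet] with s hs hM₁ hN₁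
    rwa [hs, Matrix.det_smul, hN₁, mul_one] at hM₁
  filter_upwards [hMN, hr.eventually_eq_one_of_pow_eq_one hκ hr_pow] with s hs hs₁
  rw [hs, hs₁, one_smul]

end IsRealMatrixGerm

end RealGerms

section FiniteOrder

variable {n : Type*} [Fintype n] [DecidableEq n]

lemma exists_posDef_transpose_mul_mul_eq {M : Matrix n n ℝ} (hM : IsOfFinOrder M) :
    ∃ G : Matrix n n ℝ, G.PosDef ∧ Mᵀ * G * M = G := by
  obtain ⟨m, hm, hMm⟩ := isOfFinOrder_iff_pow_eq_one.1 hM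
  refine ⟨∑ j ∈ Finset.range m, (M ^ j)ᵀ * M ^ j, ?_, ?_⟩
  · obtain ⟨r, rfl⟩ := Nat.exists_eq_succ_of_ne_zero hm.ne'
    simp only [Finset.sum_range_succ', pow_zero, Matrix.transpose_one, mul_one]
    exact .posSemidef_add (Matrix.posSemidef_sum _ fun j _ =>
      Matrix.posSemidef_conjTranspose_mul_self _) .one
  · have hterm : ∀ j, Mᵀ * ((M ^ j)ᵀ * M ^ j) * M = (M ^ (j + 1))ᵀ * M ^ (j + 1) := fun j => by
      simp only [pow_succ, Matrix.transpose_mul, mul_assoc]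
    refine add_right_cancel (b := (M ^ 0)ᵀ * M ^ 0) ?_
    simp only [Finset.mul_sum, Finset.sum_mul, hterm]
    rw [← Finset.sum_range_succ' fun j => (M ^ j)ᵀ * M ^ j, Finset.sum_range_succ, hMm, pow_zero]

open scoped MatrixOrder in
lemma exists_semiconjBy_mem_orthogonalGroup {M : Matrix n n ℝ} (hM : IsOfFinOrder M) :
    ∃ P : (Matrix n n ℝ)ˣ, ∃ N ∈ Matrix.orthogonalGroup n ℝ, SemiconjBy (P : Matrix n n ℝ) M N := by
  obtain ⟨G, hG, hGM⟩ := exists_posDef_transpose_mul_mul_eq hM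
  obtain ⟨C, hC_unit, hC⟩ := CStarAlgebra.isStrictlyPositive_iff_eq_star_mul_self.1
    (Matrix.isStrictlyPositive_iff_posDef.2 hG)
  lift C to (Matrix n n ℝ)ˣ using hC_unit
  refine ⟨C, _, (Matrix.mem_orthogonalGroup_iff' _ _).2 ?_, Units.mk_semiconjBy C M⟩
  rw [Matrix.star_eq_conjTranspose, Matrix.conjTranspose_eq_transpose_of_trivial] at hC
  set D : Matrix n n ℝ := C.val
  set D' : Matrix n n ℝ := C⁻¹.val
  have hDD' : D * D' = 1 := C.mul_inv
  calc (D * M * D')ᵀ * (D * M * D') = D'ᵀ * (Mᵀ * (Dᵀ * D) * M) * D' := by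
        simp only [Matrix.transpose_mul, mul_assoc]
    _ = (D * D')ᵀ * (D * D') := by
        rw [← hC, hGM, hC, Matrix.transpose_mul]
        simp only [mul_assoc]
    _ = 1 := by rw [hDD', Matrix.transpose_one, mul_one]

lemma det_sub_one_mul_det {N : Matrix n n ℝ} (hN : N ∈ Matrix.orthogonalGroup n ℝ) :
    (N - 1).det * N.det = (-1) ^ Fintype.card n * (N - 1).det := by
  have hflip : (N - 1)ᵀ * N = -(N - 1) := by
    have horth : Nᵀ * N = 1 := (Matrix.mem_orthogonalGroup_iff' _ _).1 hN
    rw [Matrix.transpose_sub, sub_mul, horth, Matrix.transpose_one, one_mul, neg_sub]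
  rw [← Matrix.det_neg, ← hflip, Matrix.det_mul, Matrix.det_transpose]

lemma exists_mulVec_eq_self_of_odd_card (hn : Odd (Fintype.card n)) {N : Matrix n n ℝ}
    (hN : N ∈ Matrix.specialOrthogonalGroup n ℝ) : ∃ v ≠ 0, N *ᵥ v = v := by
  have hdet : N.det = 1 := hN.2
  have hsing : (N - 1).det = 0 := by
    have h := det_sub_one_mul_det hN.1
    rw [hdet, hn.neg_one_pow] at h
    linarith
  obtain ⟨v, hv, hNv⟩ := Matrix.exists_mulVec_eq_zero_iff.2 hsing
  exact ⟨v, hv, by rwa [Matrix.sub_mulVec, Matrix.one_mulVec, sub_eq_zero] at hNv⟩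

lemma exists_mem_orthogonalGroup_mulVec_single {v : n → ℝ} (hv : v ≠ 0) (i : n) :
    ∃ O ∈ Matrix.orthogonalGroup n ℝ, ∃ c : ℝ, O *ᵥ Pi.single i 1 = c • v := by
  let x : EuclideanSpace ℝ n := WithLp.toLp 2 v
  have hx : ‖x‖ ≠ 0 := norm_ne_zero_iff.2 fun h => hv (congrArg WithLp.ofLp h)
  have hunit : Orthonormal ℝ (({i} : Set n).domRestrict fun _ => ‖x‖⁻¹ • x) :=
    ⟨fun _ => by simp [norm_smul, hx], fun j k hjk => (hjk (Subsingleton.elim j k)).elim⟩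
  have hcard : Module.finrank ℝ (EuclideanSpace ℝ n) = Fintype.card n := finrank_euclideanSpace
  obtain ⟨b, hb⟩ := hunit.exists_orthonormalBasis_extension_of_card_eq hcard
  refine ⟨_, (EuclideanSpace.basisFun n ℝ).toMatrix_orthonormalBasis_mem_orthogonal b, ‖x‖⁻¹, ?_⟩
  ext j
  simp [Module.Basis.toMatrix_apply, hb i rfl, x]

lemma det_eq_of_semiconjBy {R : Type*} [CommRing R] {P : (Matrix n n R)ˣ} {M N : Matrix n n R}
    (h : SemiconjBy (P : Matrix n n R) M N) : M.det = N.det := by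
  have h' := congrArg Matrix.det h.eq
  rw [Matrix.det_mul, Matrix.det_mul, mul_comm] at h'
  exact ((Matrix.isUnit_iff_isUnit_det _).1 P.isUnit).mul_right_cancel h'

lemma orderOf_eq_of_semiconjBy {G : Type*} [Monoid G] {a : Gˣ} {x y : G}
    (h : SemiconjBy (a : G) x y) : orderOf x = orderOf y := by
  refine orderOf_eq_orderOf_iff.2 fun k => ?_
  have hk : (a : G) * x ^ k = y ^ k * a := (h.pow_right k).eq
  exact ⟨fun hx => a.isUnit.mul_right_cancel (by rw [← hk, hx, mul_one, one_mul]),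
    fun hy => a.isUnit.mul_left_cancel (by rw [hk, hy, mul_one, one_mul])⟩

end FiniteOrder

section Rotations

/-- The multiplication by `z̄` in the real basis `1, i` of `ℂ`. For `z = exp (iθ)` this is the
rotation `u ↦ cos θ u + sin θ v`, `v ↦ -sin θ u + cos θ v`. -/
def planeRot : ℂ →* Matrix (Fin 2) (Fin 2) ℝ where
  toFun z := !![z.re, z.im; -z.im, z.re]
  map_one' := by simp [Matrix.one_fin_two]
  map_mul' z w := by
    simp only [Complex.mul_re, Complex.mul_im, Matrix.mul_fin_two]
    congr! 3 <;> ring_nf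

/-- The rotation `planeRot z` in the first two coordinates, fixing the third one. -/
def axisRot : ℂ →* Matrix (Fin 3) (Fin 3) ℝ where
  toFun z := !![z.re, z.im, 0; -z.im, z.re, 0; 0, 0, 1]
  map_one' := by simp [Matrix.one_fin_three]
  map_mul' z w := by
    ext i j
    fin_cases i <;> fin_cases j <;> simp [Matrix.mul_apply, Fin.sum_univ_three] <;> ring

lemma planeRot_apply (z : ℂ) : planeRot z = !![z.re, z.im; -z.im, z.re] := rfl

lemma axisRot_apply (z : ℂ) : axisRot z = !![z.re, z.im, 0; -z.im, z.re, 0; 0, 0, 1] := rfl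

lemma complexify_axisRot (z : ℂ) : complexify (axisRot z) =
    !![(z.re : ℂ), (z.im : ℂ), 0; -(z.im : ℂ), (z.re : ℂ), 0; 0, 0, 1] := by
  ext i j
  fin_cases i <;> fin_cases j <;> simp [complexify_apply, axisRot_apply]

lemma planeRot_injective : Function.Injective planeRot := fun _ _ h =>
  Complex.ext (congrFun₂ h 0 0) (congrFun₂ h 0 1)

lemma axisRot_injective : Function.Injective axisRot := fun _ _ h =>
  Complex.ext (congrFun₂ h 0 0) (congrFun₂ h 0 1)

lemma exists_eq_planeRot {N : Matrix (Fin 2) (Fin 2) ℝ}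
    (hN : N ∈ Matrix.specialOrthogonalGroup (Fin 2) ℝ) : ∃ z, N = planeRot z := by
  obtain ⟨h₀, h₁, -⟩ := Matrix.mem_specialOrthogonalGroup_fin_two_iff.1 hN
  refine ⟨⟨N 0 0, N 0 1⟩, ?_⟩
  rw [planeRot_apply]
  ext i j
  fin_cases i <;> fin_cases j <;> simp [h₀, h₁]

lemma exists_eq_axisRot {N : Matrix (Fin 3) (Fin 3) ℝ}
    (hN : N ∈ Matrix.specialOrthogonalGroup (Fin 3) ℝ)
    (haxis : N *ᵥ Pi.single 2 1 = Pi.single 2 1) : ∃ z, N = axisRot z := by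
  have horth : Nᵀ * N = 1 := (Matrix.mem_orthogonalGroup_iff' _ _).1 hN.1
  have haxis' : Nᵀ *ᵥ Pi.single 2 1 = Pi.single 2 1 := by
    conv_lhs => rw [← haxis, Matrix.mulVec_mulVec, horth, Matrix.one_mulVec]
  have hcol : N 0 2 = 0 ∧ N 1 2 = 0 ∧ N 2 2 = 1 := by
    simpa [funext_iff, Fin.forall_fin_succ] using haxis
  have hrow : N 2 0 = 0 ∧ N 2 1 = 0 := by
    simpa [funext_iff, Fin.forall_fin_succ, hcol.2.2] using haxis'
  have hblock : !![N 0 0, N 0 1; N 1 0, N 1 1] ∈ Matrix.specialOrthogonalGroup (Fin 2) ℝ := by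
    refine Matrix.mem_specialOrthogonalGroup_iff.2
      ⟨(Matrix.mem_orthogonalGroup_iff' _ _).2 ?_, ?_⟩
    · have h : ∀ k l, (Nᵀ * N) k l = (1 : Matrix (Fin 3) (Fin 3) ℝ) k l := congrFun₂ horth
      ext i j
      fin_cases i <;> fin_cases j
      · simpa [Matrix.mul_apply, Fin.sum_univ_three, hrow] using h 0 0
      · simpa [Matrix.mul_apply, Fin.sum_univ_three, hrow] using h 0 1
      · simpa [Matrix.mul_apply, Fin.sum_univ_three, hrow] using h 1 0
      · simpa [Matrix.mul_apply, Fin.sum_univ_three, hrow] using h 1 1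
    · have hdet : N.det = 1 := hN.2
      rw [Matrix.det_fin_three] at hdet
      rw [Matrix.det_fin_two_of]
      simpa [hcol, hrow] using hdet
  obtain ⟨z, hz⟩ := exists_eq_planeRot hblock
  refine ⟨z, ?_⟩
  simp only [planeRot_apply, EmbeddingLike.apply_eq_iff_eq, Matrix.vecCons_inj] at hz
  rw [axisRot_apply, N.eta_fin_three]
  simp [hz, hcol, hrow]

lemma isPrimitiveRoot_orderOf_of_semiconjBy {n : Type*} [Fintype n] [DecidableEq n]
    {rot : ℂ →* Matrix n n ℝ} (hrot : Function.Injective rot) {P : (Matrix n n ℝ)ˣ}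
    {M : Matrix n n ℝ} {z : ℂ} (h : SemiconjBy (P : Matrix n n ℝ) M (rot z)) :
    IsPrimitiveRoot z (orderOf M) := by
  rw [orderOf_eq_of_semiconjBy h, orderOf_injective rot hrot]
  exact IsPrimitiveRoot.orderOf z

/-- An orthogonal reflection of the plane has the eigenvalue `1`. -/
lemma exists_semiconjBy_planeRot {M : Matrix (Fin 2) (Fin 2) ℝ} (hM : IsOfFinOrder M)
    (hM₁ : (M - 1).det ≠ 0) : ∃ (P : (Matrix (Fin 2) (Fin 2) ℝ)ˣ) (z : ℂ),
      IsPrimitiveRoot z (orderOf M) ∧ SemiconjBy (P : Matrix (Fin 2) (Fin 2) ℝ) M (planeRot z) := by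
  obtain ⟨P, N, hN, hP⟩ := exists_semiconjBy_mem_orthogonalGroup hM
  have hN₁ : (N - 1).det ≠ 0 := by
    rwa [← det_eq_of_semiconjBy (hP.sub_right (SemiconjBy.one_right _))]
  have hdet : N.det = 1 := by
    have h := det_sub_one_mul_det hN
    rw [Fintype.card_fin, neg_one_sq, one_mul] at h
    exact mul_left_cancel₀ hN₁ (by rw [h, mul_one])
  obtain ⟨z, rfl⟩ := exists_eq_planeRot (Matrix.mem_specialOrthogonalGroup_iff.2 ⟨hN, hdet⟩)
  exact ⟨P, z, isPrimitiveRoot_orderOf_of_semiconjBy planeRot_injective hP, hP⟩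

lemma exists_semiconjBy_axisRot {M : Matrix (Fin 3) (Fin 3) ℝ} (hM : IsOfFinOrder M)
    (hdet : M.det = 1) : ∃ (P : (Matrix (Fin 3) (Fin 3) ℝ)ˣ) (z : ℂ),
      IsPrimitiveRoot z (orderOf M) ∧ SemiconjBy (P : Matrix (Fin 3) (Fin 3) ℝ) M (axisRot z) := by
  obtain ⟨P, N, hN, hP⟩ := exists_semiconjBy_mem_orthogonalGroup hM
  rw [det_eq_of_semiconjBy hP] at hdet
  obtain ⟨v, hv, hNv⟩ := exists_mulVec_eq_self_of_odd_card (by decide)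
    (Matrix.mem_specialOrthogonalGroup_iff.2 ⟨hN, hdet⟩)
  obtain ⟨O, hO, c, hOv⟩ := exists_mem_orthogonalGroup_mulVec_single hv 2
  let U : Matrix.orthogonalGroup (Fin 3) ℝ := ⟨O, hO⟩
  let K : Matrix.orthogonalGroup (Fin 3) ℝ := U⁻¹ * ⟨N, hN⟩ * U
  let Q : (Matrix (Fin 3) (Fin 3) ℝ)ˣ := Unitary.toUnits U
  have hOK : O * K.1 = N * O :=
    congrArg Subtype.val (show U * K = ⟨N, hN⟩ * U by simp [K, mul_assoc])
  have hQ : SemiconjBy ((Q⁻¹ : (Matrix (Fin 3) (Fin 3) ℝ)ˣ) : Matrix (Fin 3) (Fin 3) ℝ) N K.1 :=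
    SemiconjBy.units_inv_symm_left hOK
  have hK : K.1 *ᵥ Pi.single 2 1 = Pi.single 2 1 := by
    refine Matrix.mulVec_injective_of_isUnit Q.isUnit ?_
    change O *ᵥ _ = O *ᵥ _
    rw [Matrix.mulVec_mulVec, hOK, ← Matrix.mulVec_mulVec, hOv, Matrix.mulVec_smul, hNv]
  obtain ⟨z, hz⟩ := exists_eq_axisRot
    (Matrix.mem_specialOrthogonalGroup_iff.2 ⟨K.2, (det_eq_of_semiconjBy hQ).symm.trans hdet⟩) hK
  have h : SemiconjBy ((Q⁻¹ * P : (Matrix (Fin 3) (Fin 3) ℝ)ˣ) : Matrix (Fin 3) (Fin 3) ℝ) M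
      (axisRot z) := by
    rw [← hz, Units.val_mul]
    exact hQ.mul_left hP
  exact ⟨Q⁻¹ * P, z, isPrimitiveRoot_orderOf_of_semiconjBy axisRot_injective h, h⟩

end Rotations

section CyclicActions

/-- The primitive `m`-th root of unity `exp (2πi / m)`. The generator acts by `planeRot` of its
powers in the representations `R_{a, m}`. -/
noncomputable def stdRoot (m : ℕ) : ℂ := Complex.exp (2 * Real.pi * Complex.I / m)

lemma isPrimitiveRoot_stdRoot (m : ℕ) [NeZero m] : IsPrimitiveRoot (stdRoot m) m :=
  Complex.isPrimitiveRoot_exp m (NeZero.ne m)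

lemma stdRoot_pow (m j : ℕ) :
    stdRoot m ^ j = Complex.exp ((2 * Real.pi * j / m : ℝ) * Complex.I) := by
  rw [stdRoot, ← Complex.exp_nat_mul]
  congr 1
  push_cast
  ring

lemma fibRot_eq_complexify (m j : ℕ) : fibRot m j = complexify (axisRot (stdRoot m ^ j)) := by
  ext i k
  rw [complexify_apply, axisRot_apply, stdRoot_pow, Complex.exp_ofReal_mul_I_re,
    Complex.exp_ofReal_mul_I_im]
  fin_cases i <;> fin_cases k <;> simp [fibRot, -Complex.ofReal_cos, -Complex.ofReal_sin]

lemma norm_stdRoot_pow (m j : ℕ) : ‖stdRoot m ^ j‖ = 1 := by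
  rw [stdRoot_pow, Complex.norm_exp_ofReal_mul_I]

lemma dvd_two_mul_of_im_stdRoot_pow_eq_zero [NeZero m] {j : ℕ} (h : (stdRoot m ^ j).im = 0) :
    m ∣ 2 * j := by
  have hsq : (stdRoot m ^ j).re ^ 2 = 1 := by
    have hnorm := Complex.sq_norm (stdRoot m ^ j)
    rw [norm_stdRoot_pow, Complex.normSq_apply, h] at hnorm
    linear_combination -hnorm
  rw [← (isPrimitiveRoot_stdRoot m).pow_eq_one_iff_dvd, mul_comm, pow_mul,
    ← Complex.re_add_im (stdRoot m ^ j), h, Complex.ofReal_zero, zero_mul, add_zero]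
  exact_mod_cast hsq

lemma baseRot_eq_complexify (m b j : ℕ) :
    baseRot m b j = complexify (planeRot (stdRoot m ^ (b * j))) := by
  ext i k
  rw [complexify_apply, planeRot_apply, stdRoot_pow, Complex.exp_ofReal_mul_I_re,
    Complex.exp_ofReal_mul_I_im, Nat.cast_mul, ← mul_assoc]
  fin_cases i <;> fin_cases k <;> simp [baseRot, -Complex.ofReal_cos, -Complex.ofReal_sin]

variable {m : ℕ}

lemma orderOf_ofAdd_unit (g : (ZMod m)ˣ) : orderOf (Multiplicative.ofAdd (g : ZMod m)) = m := by
  rw [orderOf_ofAdd_eq_addOrderOf, ← mul_one (g : ZMod m)]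
  exact (addOrderOf_injective (AddMonoidHom.mulLeft (g : ZMod m))
    g.isUnit.mul_right_injective 1).trans (ZMod.addOrderOf_one m)

lemma orderOf_apply_ofAdd_unit {n : Type*} [Fintype n] [DecidableEq n]
    {ρ : Multiplicative (ZMod m) →* Matrix n n ℝ} (hρ : Function.Injective ρ) (g : (ZMod m)ˣ) :
    orderOf (ρ (.ofAdd g)) = m :=
  (orderOf_injective ρ hρ _).trans (orderOf_ofAdd_unit g)

variable [NeZero m]

lemma exists_unit_semiconjBy_axisRot {ρ : Multiplicative (ZMod m) →* Matrix (Fin 3) (Fin 3) ℝ}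
    (hρ : Function.Injective ρ) (hdet : (ρ (.ofAdd 1)).det = 1) :
    ∃ (g : (ZMod m)ˣ) (P : (Matrix (Fin 3) (Fin 3) ℝ)ˣ), ∀ j : ℕ,
      SemiconjBy (P : Matrix (Fin 3) (Fin 3) ℝ) (ρ (.ofAdd (j * g))) (axisRot (stdRoot m ^ j)) := by
  have hfin : IsOfFinOrder (ρ (.ofAdd 1)) := ρ.isOfFinOrder (isOfFinOrder_of_finite _)
  obtain ⟨P, z, hz, hP⟩ := exists_semiconjBy_axisRot hfin hdet
  rw [← Units.val_one, orderOf_apply_ofAdd_unit hρ] at hz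
  obtain ⟨i, -, hi, hzi⟩ := hz.isPrimitiveRoot_iff.1 (isPrimitiveRoot_stdRoot m)
  refine ⟨ZMod.unitOfCoprime i hi, P, fun j => ?_⟩
  have h := hP.pow_right (i * j)
  rw [← map_pow ρ, ← ofAdd_nsmul, ← map_pow axisRot, pow_mul, hzi, nsmul_one] at h
  rwa [ZMod.coe_unitOfCoprime, mul_comm, ← Nat.cast_mul]

lemma exists_coprime_semiconjBy_planeRot
    {ρ : Multiplicative (ZMod m) →* Matrix (Fin 2) (Fin 2) ℝ} (hρ : Function.Injective ρ)
    (g : (ZMod m)ˣ) (hg : (ρ (.ofAdd g) - 1).det ≠ 0) :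
    ∃ (b : ℕ) (P : (Matrix (Fin 2) (Fin 2) ℝ)ˣ), b.Coprime m ∧
      SemiconjBy (P : Matrix (Fin 2) (Fin 2) ℝ) (ρ (.ofAdd g)) (planeRot (stdRoot m ^ b)) := by
  have hfin : IsOfFinOrder (ρ (.ofAdd g)) := ρ.isOfFinOrder (isOfFinOrder_of_finite _)
  obtain ⟨P, z, hz, hP⟩ := exists_semiconjBy_planeRot hfin hg
  rw [orderOf_apply_ofAdd_unit hρ] at hz
  obtain ⟨b, -, hb, rfl⟩ := (isPrimitiveRoot_stdRoot m).isPrimitiveRoot_iff.1 hz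
  exact ⟨b, P, hb, hP⟩

end CyclicActions

namespace RealConicBundle

variable (X : RealConicBundle)

lemma eventually_mem : ∀ᶠ s in 𝓝 (0 : BaseC), s ∈ X.S := X.isOpen_S.mem_nhds X.zero_mem

lemma isRealMatrixGerm {M : BaseC → Matrix (Fin 3) (Fin 3) ℂ} (hM : MatAnalyticOn M X.S)
    (hM' : MatRealOn M X.S) : IsRealMatrixGerm M := fun i j =>
  ⟨hM i j 0 X.zero_mem, by filter_upwards [X.eventually_mem] with s hs; rw [hM' s hs]; rfl⟩

lemma isRealMatrixGerm_form : IsRealMatrixGerm X.Q := X.isRealMatrixGerm X.analytic X.real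

end RealConicBundle

namespace ConicBundleAction

variable {X : RealConicBundle} {m : ℕ} (α : ConicBundleAction X m)

lemma isRealGerm_base (k : ZMod m) : IsRealGerm (α.σ k) :=
  ⟨α.σ_analytic k 0 X.zero_mem, X.eventually_mem.mono (α.σ_real k)⟩

lemma isRealMatrixGerm_fibre (k : ZMod m) : IsRealMatrixGerm (α.A k) :=
  X.isRealMatrixGerm (α.A_analytic k) (α.A_real k)

/-- A lift of the projective action on the fibres near `0` to a linear action of determinant
one. -/
structure IsUnimodularLift (A' : ZMod m → BaseC → Matrix (Fin 3) (Fin 3) ℂ) : Prop where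
  isRealMatrixGerm : ∀ k, IsRealMatrixGerm (A' k)
  det_eq_one : ∀ k, ∀ᶠ s in 𝓝 (0 : BaseC), (A' k s).det = 1
  proportional : ∀ k, ∀ᶠ s in 𝓝 (0 : BaseC), ∃ c : ℂ, c ≠ 0 ∧ α.A k s = c • A' k s
  cocycle : ∀ k l, ∀ᶠ s in 𝓝 (0 : BaseC), A' (k + l) s = A' k (α.σ l s) * A' l s

variable {α}

/-- The scaling factor is a real cube root of `1 / det`, hence unique: this makes the lift
multiplicative. -/
lemma exists_isUnimodularLift (h_zero : ∀ k, α.σ k 0 = 0) : ∃ A', α.IsUnimodularLift A' := by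
  have hodd : Odd (Fintype.card (Fin 3)) := by decide
  choose u hu hu_det using fun k =>
    (α.isRealMatrixGerm_fibre k).exists_det_smul_eq_one hodd (α.A_det k 0 X.zero_mem)
  have hgerm : ∀ k, IsRealMatrixGerm fun s => u k s • α.A k s := fun k =>
    .smul (hu k) (α.isRealMatrixGerm_fibre k)
  have hprop : ∀ k, ∀ᶠ s in 𝓝 (0 : BaseC), ∃ c : ℂ, c ≠ 0 ∧ α.A k s = c • (u k s • α.A k s) :=
    fun k => by
      filter_upwards [hu_det k] with s hs
      have hus : u k s ≠ 0 := fun h => by simp [h] at hs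
      exact ⟨(u k s)⁻¹, inv_ne_zero hus, (inv_smul_smul₀ hus _).symm⟩
  refine ⟨fun k s => u k s • α.A k s, hgerm, hu_det, hprop, fun k l => ?_⟩
  have hσ := (α.isRealGerm_base l).tendsto_zero (h_zero l)
  refine (hgerm (k + l)).eventually_eq_of_proportional hodd
    (((hgerm k).comp (α.isRealGerm_base l) (h_zero l)).mul (hgerm l)) (hu_det (k + l)) ?_ ?_
  · filter_upwards [hσ.eventually (hu_det k), hu_det l] with s hk hl
    rw [Matrix.det_mul, hk, hl, mul_one]
  · filter_upwards [X.eventually_mem, hσ.eventually (hprop k), hprop l] with s hs ⟨c, _, hc⟩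
      ⟨d, _, hd⟩
    obtain ⟨e, -, he⟩ := α.A_add k l s hs
    refine ⟨u (k + l) s * (e * (d * c)), ?_⟩
    rw [he, mul_smul, mul_smul, mul_smul]
    conv_lhs => rw [hc, hd]
    simp only [Matrix.smul_mul, Matrix.mul_smul, smul_comm c]

namespace IsUnimodularLift

variable {A' : ZMod m → BaseC → Matrix (Fin 3) (Fin 3) ℂ}

lemma exists_representation (hA' : α.IsUnimodularLift A') (h_zero : ∀ k, α.σ k 0 = 0) :
    ∃ ρ : Multiplicative (ZMod m) →* Matrix (Fin 3) (Fin 3) ℝ,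
      ∀ k, complexify (ρ (.ofAdd k)) = A' k 0 ∧ (ρ (.ofAdd k)).det = 1 := by
  choose N hN using fun k => (hA'.isRealMatrixGerm k).exists_complexify_eq
  have hdet : ∀ k, (N k).det = 1 := fun k => by
    have h := (hA'.det_eq_one k).self_of_nhds
    rw [← hN, det_complexify] at h
    exact_mod_cast h
  have hadd : ∀ k l, N (k + l) = N k * N l := fun k l => complexify_injective <| by
    rw [map_mul, hN, hN, hN, (hA'.cocycle k l).self_of_nhds, h_zero]
  have hzero : N 0 = 1 := by
    have hunit : IsUnit (N 0) := (Matrix.isUnit_iff_isUnit_det _).2 (by simp [hdet])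
    exact hunit.mul_left_cancel (by rw [← hadd, add_zero, mul_one])
  exact ⟨⟨⟨fun k => N k.toAdd, hzero⟩, fun k l => hadd k.toAdd l.toAdd⟩, fun k => ⟨hN k, hdet k⟩⟩

lemma injective_representation (hA' : α.IsUnimodularLift A') (h_zero : ∀ k, α.σ k 0 = 0)
    (h_real : ∃ p ∈ X.total, p.2 = 0 ∧ IsRealPt p)
    (h_fix : ∀ k : ZMod m, k ≠ 0 → ∀ p ∈ α.fixedPts k, ¬ IsRealPt p)
    {ρ : Multiplicative (ZMod m) →* Matrix (Fin 3) (Fin 3) ℝ}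
    (hρ : ∀ k, complexify (ρ (.ofAdd k)) = A' k 0) : Function.Injective ρ := by
  refine (injective_iff_map_eq_one ρ).2 fun k hk => ?_
  by_contra hk₁
  obtain ⟨p, hp, hp0, hp_real⟩ := h_real
  refine h_fix k.toAdd hk₁ p ⟨hp, by rw [hp0, h_zero], ?_⟩ hp_real
  obtain ⟨c, -, hc⟩ := (hA'.proportional k.toAdd).self_of_nhds
  refine ⟨c, ?_⟩
  rw [hp0, hc, ← hρ, ofAdd_toAdd, hk, map_one, Matrix.smul_mulVec, Matrix.one_mulVec]

/-- Averaging `ρ (-k) A' k` over the group. -/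
lemma exists_intertwiner [NeZero m] (hA' : α.IsUnimodularLift A')
    {ρ : Multiplicative (ZMod m) →* Matrix (Fin 3) (Fin 3) ℝ}
    (hρ : ∀ k, complexify (ρ (.ofAdd k)) = A' k 0) :
    ∃ B, IsRealMatrixGerm B ∧ (B 0).det ≠ 0 ∧ ∀ l, ∀ᶠ s in 𝓝 (0 : BaseC),
      B (α.σ l s) * A' l s = complexify (ρ (.ofAdd l)) * B s := by
  have hρ_add : ∀ k l, complexify (ρ (.ofAdd (k + l))) =
      complexify (ρ (.ofAdd k)) * complexify (ρ (.ofAdd l)) := fun k l => by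
    rw [ofAdd_add, map_mul, map_mul]
  refine ⟨fun s => ∑ k, complexify (ρ (.ofAdd (-k))) * A' k s,
    .sum _ fun k _ => .mul (.complexify _) (hA'.isRealMatrixGerm k), ?_, fun l => ?_⟩
  · have hterm : ∀ k, complexify (ρ (.ofAdd (-k))) * A' k 0 = 1 := fun k => by
      rw [← hρ, ← hρ_add, neg_add_cancel, ofAdd_zero, map_one, map_one]
    beta_reduce
    rw [Finset.sum_congr rfl fun k _ => hterm k, Finset.sum_const, Finset.card_univ, ZMod.card,
      ← Nat.cast_smul_eq_nsmul ℂ, Matrix.det_smul, Matrix.det_one, mul_one]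
    exact pow_ne_zero _ (NeZero.ne _)
  · filter_upwards [eventually_all.2 fun k => hA'.cocycle k l] with s hs
    rw [Finset.sum_mul, Finset.mul_sum]
    conv_rhs => rw [← Equiv.sum_comp (Equiv.addRight l)]
    refine Finset.sum_congr rfl fun k _ => ?_
    have hkl : -k = l + -(k + l) := by abel
    simp only [Equiv.coe_addRight]
    rw [hkl, hρ_add, hs, mul_assoc, mul_assoc]

end IsUnimodularLift

variable (α) in
/-- Near `0` the generator `g` acts linearly, by `𝟏(z) ⊕ R_{1,m}(x, y)`, in the fibre coordinates
`B`. -/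
structure IsLinearFrame (g : (ZMod m)ˣ) (B : BaseC → Matrix (Fin 3) (Fin 3) ℂ) : Prop where
  isRealMatrixGerm : IsRealMatrixGerm B
  det_ne_zero : (B 0).det ≠ 0
  linear : ∀ j : ℕ, ∀ᶠ s in 𝓝 (0 : BaseC), ∃ c : ℂ, c ≠ 0 ∧
    B (α.σ (j * g) s) * α.A (j * g) s = c • (fibRot m j * B s)

lemma exists_isLinearFrame [NeZero m] (h_zero : ∀ k, α.σ k 0 = 0)
    (h_real : ∃ p ∈ X.total, p.2 = 0 ∧ IsRealPt p)
    (h_fix : ∀ k : ZMod m, k ≠ 0 → ∀ p ∈ α.fixedPts k, ¬ IsRealPt p) :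
    ∃ (g : (ZMod m)ˣ) (B : BaseC → Matrix (Fin 3) (Fin 3) ℂ), α.IsLinearFrame g B := by
  obtain ⟨A', hA'⟩ := exists_isUnimodularLift h_zero
  obtain ⟨ρ, hρ⟩ := hA'.exists_representation h_zero
  obtain ⟨B, hB, hB_det, hBA⟩ := hA'.exists_intertwiner fun k => (hρ k).1
  obtain ⟨g, P, hP⟩ := exists_unit_semiconjBy_axisRot
    (hA'.injective_representation h_zero h_real h_fix fun k => (hρ k).1) (hρ 1).2
  refine ⟨g, fun s => complexify P * B s, (IsRealMatrixGerm.complexify _).mul hB, ?_, fun j => ?_⟩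
  · have hP_det : (P : Matrix (Fin 3) (Fin 3) ℝ).det ≠ 0 :=
      ((Matrix.isUnit_iff_isUnit_det _).1 P.isUnit).ne_zero
    rw [Matrix.det_mul, det_complexify]
    exact mul_ne_zero (by exact_mod_cast hP_det) hB_det
  · filter_upwards [hBA (j * g), hA'.proportional (j * g)] with s hs ⟨c, hc0, hc⟩
    refine ⟨c, hc0, ?_⟩
    rw [hc, Matrix.mul_smul, mul_assoc, hs, fibRot_eq_complexify, ← mul_assoc, ← mul_assoc,
      ← map_mul, ← map_mul, (hP j).eq]

end ConicBundleAction

section Congruence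

variable {n R : Type*} [Fintype n] [CommRing R] {M : Matrix n n R}

lemma isSymm_transpose_mul_mul (hM : M.IsSymm) (C : Matrix n n R) : (Cᵀ * M * C).IsSymm := by
  rw [Matrix.IsSymm, Matrix.transpose_mul, Matrix.transpose_mul, Matrix.transpose_transpose, hM.eq,
    Matrix.mul_assoc]

lemma transpose_inv_mul_mul_inv [DecidableEq n] {T : Matrix n n R} (hT : IsUnit T.det) :
    T⁻¹ᵀ * (Tᵀ * M * T) * T⁻¹ = M := by
  have hTinv : T * T⁻¹ = 1 := T.mul_nonsing_inv hT
  calc T⁻¹ᵀ * (Tᵀ * M * T) * T⁻¹ = (T * T⁻¹)ᵀ * M * (T * T⁻¹) := by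
        simp only [Matrix.transpose_mul, Matrix.mul_assoc]
    _ = M := by rw [hTinv, Matrix.transpose_one, Matrix.one_mul, Matrix.mul_one]

end Congruence

section QuadraticForms

variable (M N : Matrix (Fin 3) (Fin 3) ℂ) (v : FibC)

lemma quadVal_transpose_mul_mul (C : Matrix (Fin 3) (Fin 3) ℂ) :
    quadVal (Cᵀ * M * C) v = quadVal M (C *ᵥ v) := by
  unfold quadVal
  rw [← Matrix.mulVec_mulVec, ← Matrix.mulVec_mulVec, Matrix.dotProduct_mulVec,
    Matrix.vecMul_transpose]

lemma quadVal_smul_right (c : ℂ) : quadVal M (c • v) = c ^ 2 * quadVal M v := by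
  simp only [quadVal, Matrix.mulVec_smul, dotProduct_smul, smul_dotProduct, smul_eq_mul]
  ring

lemma quadVal_smul_left (c : ℂ) : quadVal (c • M) v = c * quadVal M v := by
  simp only [quadVal, Matrix.smul_mulVec, dotProduct_smul, smul_eq_mul]

lemma quadVal_sub_left : quadVal (M - N) v = quadVal M v - quadVal N v := by
  simp only [quadVal, Matrix.sub_mulVec, dotProduct_sub]

lemma quadVal_single (i : Fin 3) : quadVal M (Pi.single i 1) = M i i := by
  simp [quadVal]

variable {M N}

lemma eq_of_quadVal_eq (hM : M.IsSymm) (hN : N.IsSymm) (h : ∀ v, quadVal M v = quadVal N v) :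
    M = N := by
  ext i j
  have hi := h (Pi.single i 1)
  have hj := h (Pi.single j 1)
  have hij := h (Pi.single i 1 + Pi.single j 1)
  rw [quadVal_single, quadVal_single] at hi hj
  simp only [quadVal, Matrix.mulVec_add, dotProduct_add, add_dotProduct, Matrix.mulVec_single_one,
    single_one_dotProduct, Matrix.col_apply] at hij
  rw [hi, hj, hM.apply i j, hN.apply i j] at hij
  linear_combination hij / 2

/-- The matrix of the quadratic form `z² + a x² + 2 b x y + c y²`. -/
def blockForm (a b c : ℂ) : Matrix (Fin 3) (Fin 3) ℂ := !![a, b, 0; b, c, 0; 0, 0, 1]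

lemma quadVal_blockForm (a b c : ℂ) (v : FibC) :
    quadVal (blockForm a b c) v = v 2 ^ 2 + a * v 0 ^ 2 + 2 * b * v 0 * v 1 + c * v 1 ^ 2 := by
  simp [quadVal, blockForm, Matrix.mulVec, dotProduct, Fin.sum_univ_three]
  ring

lemma isSymm_blockForm (a b c : ℂ) : (blockForm a b c).IsSymm := by
  ext i j
  fin_cases i <;> fin_cases j <;> rfl

lemma isRealMatrixGerm_blockForm {a b c : BaseC → ℂ} (ha : IsRealGerm a) (hb : IsRealGerm b)
    (hc : IsRealGerm c) : IsRealMatrixGerm fun s => blockForm (a s) (b s) (c s) := fun i j => by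
  fin_cases i <;> fin_cases j
  exacts [ha, hb, .const (star_zero ℂ), hb, hc, .const (star_zero ℂ), .const (star_zero ℂ),
    .const (star_zero ℂ), .const (star_one ℂ)]

/-- The change of coordinates that adds `p x + q y` to `z`: it completes the square. -/
def shear (p q : ℂ) : Matrix (Fin 3) (Fin 3) ℂ := !![1, 0, 0; 0, 1, 0; p, q, 1]

lemma det_shear (p q : ℂ) : (shear p q).det = 1 := by
  simp [shear, Matrix.det_fin_three]

lemma isRealMatrixGerm_shear {p q : BaseC → ℂ} (hp : IsRealGerm p) (hq : IsRealGerm q) :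
    IsRealMatrixGerm fun s => shear (p s) (q s) := fun i j => by
  fin_cases i <;> fin_cases j
  exacts [.const (star_one ℂ), .const (star_zero ℂ), .const (star_zero ℂ), .const (star_zero ℂ),
    .const (star_one ℂ), .const (star_zero ℂ), hp, hq, .const (star_one ℂ)]

lemma transpose_shear_mul_blockForm_mul_shear (hM : M.IsSymm) (h : M 2 2 = 1) :
    (shear (M 2 0) (M 2 1))ᵀ * blockForm (M 0 0 - M 2 0 * M 2 0) (M 0 1 - M 2 0 * M 2 1)
      (M 1 1 - M 2 1 * M 2 1) * shear (M 2 0) (M 2 1) = M := by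
  ext i j
  fin_cases i <;> fin_cases j <;>
    simp [shear, blockForm, Matrix.mul_apply, Fin.sum_univ_three, hM.apply 0 1, hM.apply 0 2,
      hM.apply 1 2, h]
  all_goals ring

lemma fibRot_mulVec_single_two (m j : ℕ) :
    fibRot m j *ᵥ Pi.single 2 1 = Pi.single 2 1 := by
  ext i
  fin_cases i <;> simp [fibRot]

lemma shear_mul_fibRot {m j : ℕ} (h : (fibRot m j)ᵀ * N * fibRot m j = M) :
    shear (N 2 0) (N 2 1) * fibRot m j = fibRot m j * shear (M 2 0) (M 2 1) := by
  rw [← h, fibRot_eq_complexify, complexify_axisRot]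
  ext i k
  fin_cases i <;> fin_cases k <;> simp [shear, Matrix.mul_apply, Fin.sum_univ_three]

end QuadraticForms

namespace RealConicBundle

variable (X : RealConicBundle)

/-- The matrix of the equation of `X` in the fibre coordinates `B`. -/
noncomputable def formIn (B : BaseC → Matrix (Fin 3) (Fin 3) ℂ) (s : BaseC) :
    Matrix (Fin 3) (Fin 3) ℂ := (B s)⁻¹ᵀ * X.Q s * (B s)⁻¹

variable {B : BaseC → Matrix (Fin 3) (Fin 3) ℂ}

lemma isRealMatrixGerm_formIn (hB : IsRealMatrixGerm B) (hB_det : (B 0).det ≠ 0) :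
    IsRealMatrixGerm (X.formIn B) :=
  ((hB.inv hB_det).transpose.mul X.isRealMatrixGerm_form).mul (hB.inv hB_det)

lemma isSymm_formIn {s : BaseC} (hs : s ∈ X.S) : (X.formIn B s).IsSymm :=
  isSymm_transpose_mul_mul (X.symm s hs) _

lemma quadVal_formIn (s : BaseC) (v : FibC) :
    quadVal (X.formIn B s) v = quadVal (X.Q s) ((B s)⁻¹ *ᵥ v) :=
  quadVal_transpose_mul_mul _ _ _

lemma quadVal_formIn_mulVec {s : BaseC} (hs : (B s).det ≠ 0) (v : FibC) :
    quadVal (X.formIn B s) (B s *ᵥ v) = quadVal (X.Q s) v := by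
  rw [quadVal_formIn, Matrix.mulVec_mulVec, Matrix.nonsing_inv_mul _ hs.isUnit, Matrix.one_mulVec]

lemma formIn_mul (T : BaseC → Matrix (Fin 3) (Fin 3) ℂ) (s : BaseC) :
    X.formIn (fun s => T s * B s) s = (T s)⁻¹ᵀ * X.formIn B s * (T s)⁻¹ := by
  simp only [formIn, Matrix.mul_inv_rev, Matrix.transpose_mul, Matrix.mul_assoc]

end RealConicBundle

namespace ConicBundleAction

variable {X : RealConicBundle} {m : ℕ} {α : ConicBundleAction X m} {g : (ZMod m)ˣ}
  {B : BaseC → Matrix (Fin 3) (Fin 3) ℂ}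

namespace IsLinearFrame

lemma eventually_det_ne_zero (hB : α.IsLinearFrame g B) :
    ∀ᶠ s in 𝓝 (0 : BaseC), (B s).det ≠ 0 :=
  hB.isRealMatrixGerm.eventually_det_ne_zero hB.det_ne_zero

lemma mul (hB : α.IsLinearFrame g B) {T : BaseC → Matrix (Fin 3) (Fin 3) ℂ}
    (hT : IsRealMatrixGerm T) (hT_det : (T 0).det ≠ 0)
    (hT_comm : ∀ j : ℕ, ∀ᶠ s in 𝓝 (0 : BaseC),
      T (α.σ (j * g) s) * fibRot m j = fibRot m j * T s) :
    α.IsLinearFrame g fun s => T s * B s where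
  isRealMatrixGerm := hT.mul hB.isRealMatrixGerm
  det_ne_zero := by rw [Matrix.det_mul]; exact mul_ne_zero hT_det hB.det_ne_zero
  linear j := by
    filter_upwards [hB.linear j, hT_comm j] with s ⟨c, hc0, hc⟩ hT
    refine ⟨c, hc0, ?_⟩
    rw [Matrix.mul_assoc, hc, Matrix.mul_smul, ← Matrix.mul_assoc, hT, Matrix.mul_assoc]

lemma eventually_mem_fixedPts (hB : α.IsLinearFrame g B) (j : ℕ) :
    ∀ᶠ s in 𝓝 (0 : BaseC), α.σ (j * g) s = s → ∀ (v : FibC) (l : ℂ), v ≠ 0 →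
      fibRot m j *ᵥ v = l • v → quadVal (X.formIn B s) v = 0 →
      ((B s)⁻¹ *ᵥ v, s) ∈ α.fixedPts (j * g) := by
  filter_upwards [X.eventually_mem, hB.eventually_det_ne_zero, hB.linear j] with s hs hdet
    ⟨c, _, hc⟩ hσ v l hv hl hq
  have hcancel : B s *ᵥ (B s)⁻¹ *ᵥ v = v := by
    rw [Matrix.mulVec_mulVec, Matrix.mul_nonsing_inv _ hdet.isUnit, Matrix.one_mulVec]
  have hA : α.A (j * g) s = (B s)⁻¹ * (c • (fibRot m j * B s)) := by
    rw [← hc, hσ, Matrix.nonsing_inv_mul_cancel_left _ _ hdet.isUnit]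
  refine ⟨⟨fun h => hv ?_, hs, (X.quadVal_formIn s v).symm.trans hq⟩, hσ, c * l, ?_⟩
  · rw [← hcancel, show (B s)⁻¹ *ᵥ v = 0 from h, Matrix.mulVec_zero]
  · rw [hA, ← Matrix.mulVec_mulVec, Matrix.smul_mulVec, ← Matrix.mulVec_mulVec, hcancel, hl,
      smul_smul, Matrix.mulVec_smul]

lemma quadVal_formIn_zero_ne_zero (hB : α.IsLinearFrame g B) (h_zero : ∀ k, α.σ k 0 = 0)
    (h_fix : ∀ k : ZMod m, k ≠ 0 → ∀ p ∈ α.fixedPts k, ¬ IsRealPt p) {j : ℕ}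
    (hj : (j : ZMod m) ≠ 0) {v : FibC} (hv : v ≠ 0) (hv_real : star v = v) {l : ℂ}
    (hl : fibRot m j *ᵥ v = l • v) : quadVal (X.formIn B 0) v ≠ 0 := fun hq => by
  have hjg : (j : ZMod m) * g ≠ 0 := by rwa [Ne, Units.mul_left_eq_zero]
  refine h_fix _ hjg _ ((hB.eventually_mem_fixedPts j).self_of_nhds (h_zero _) v l hv hl hq)
    ⟨star_zero _, 1, ?_⟩
  rw [one_smul]
  exact (hB.isRealMatrixGerm.inv hB.det_ne_zero).star_mulVec_zero hv_real

lemma eventually_quadVal_formIn (hB : α.IsLinearFrame g B) (h_zero : ∀ k, α.σ k 0 = 0) (j : ℕ) :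
    ∀ᶠ s in 𝓝 (0 : BaseC), ∃ c : ℂ, c ≠ 0 ∧ ∀ v,
      quadVal (X.formIn B (α.σ (j * g) s)) (fibRot m j *ᵥ v) = c * quadVal (X.formIn B s) v := by
  have hσ := (α.isRealGerm_base (j * g)).tendsto_zero (h_zero _)
  filter_upwards [X.eventually_mem, hB.linear j, hB.eventually_det_ne_zero,
    hσ.eventually hB.eventually_det_ne_zero] with s hs ⟨c, hc0, hc⟩ hd hd'
  obtain ⟨e, he0, he⟩ := α.preserves (j * g) s hs
  refine ⟨e * c⁻¹ ^ 2, mul_ne_zero he0 (pow_ne_zero _ (inv_ne_zero hc0)), fun v => ?_⟩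
  obtain ⟨w, rfl⟩ : ∃ w, v = B s *ᵥ w :=
    ⟨(B s)⁻¹ *ᵥ v, by rw [Matrix.mulVec_mulVec, Matrix.mul_nonsing_inv _ hd.isUnit,
      Matrix.one_mulVec]⟩
  have hrot : fibRot m j *ᵥ B s *ᵥ w = B (α.σ (j * g) s) *ᵥ (c⁻¹ • α.A (j * g) s *ᵥ w) := by
    rw [Matrix.mulVec_smul, Matrix.mulVec_mulVec, Matrix.mulVec_mulVec, hc, Matrix.smul_mulVec,
      inv_smul_smul₀ hc0]
  rw [hrot, X.quadVal_formIn_mulVec hd', quadVal_smul_right, he, X.quadVal_formIn_mulVec hd]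
  ring

lemma transpose_fibRot_mul_mul_fibRot (hB : α.IsLinearFrame g B) (h_zero : ∀ k, α.σ k 0 = 0)
    {D : BaseC → Matrix (Fin 3) (Fin 3) ℂ}
    (hD : ∀ᶠ s in 𝓝 (0 : BaseC), D s 2 2 = 1 ∧ ∃ ε : ℂ, D s = ε • X.formIn B s) (j : ℕ) :
    ∀ᶠ s in 𝓝 (0 : BaseC), (fibRot m j)ᵀ * D (α.σ (j * g) s) * fibRot m j = D s := by
  have hσ := (α.isRealGerm_base (j * g)).tendsto_zero (h_zero _)
  filter_upwards [X.eventually_mem, hB.eventually_quadVal_formIn h_zero j, hD,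
    hσ.eventually hD] with s hs ⟨c, _, hc⟩ ⟨h22, ε, hε⟩ ⟨h22', ε', hε'⟩
  have hz := hc (Pi.single 2 1)
  rw [fibRot_mulVec_single_two, quadVal_single, quadVal_single] at hz
  rw [hε, Matrix.smul_apply, smul_eq_mul] at h22
  rw [hε', Matrix.smul_apply, smul_eq_mul, hz] at h22'
  have hfactor : ε' * c = ε := by linear_combination ε * h22' - ε' * c * h22
  rw [hε, hε']
  refine eq_of_quadVal_eq
    (isSymm_transpose_mul_mul ((X.isSymm_formIn (α.σ_mapsTo _ hs)).smul _) _)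
    ((X.isSymm_formIn hs).smul _) fun v => ?_
  rw [quadVal_transpose_mul_mul, quadVal_smul_left, quadVal_smul_left, hc, ← hfactor]
  ring

end IsLinearFrame

variable (α) in
/-- A linear frame `B` in which the equation of the conic bundle, multiplied by the unit `e`, is
`z² + a x² + 2 b x y + c y²`. -/
structure IsBlockForm (g : (ZMod m)ˣ) (B : BaseC → Matrix (Fin 3) (Fin 3) ℂ)
    (a b c e : BaseC → ℂ) : Prop extends α.IsLinearFrame g B where
  isRealGerm_a : IsRealGerm a
  isRealGerm_b : IsRealGerm b
  isRealGerm_c : IsRealGerm c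
  isRealGerm_e : IsRealGerm e
  e_ne_zero : e 0 ≠ 0
  equation : ∀ᶠ s in 𝓝 (0 : BaseC), blockForm (a s) (b s) (c s) = e s • X.formIn B s

/-- The point `(0 : 0 : 1)` is fixed, so it is not on the central fibre: the coefficient of `z²` is
a unit, and one can complete the square. -/
lemma IsLinearFrame.exists_isBlockForm (hB : α.IsLinearFrame g B) (hm : 1 < m)
    (h_zero : ∀ k, α.σ k 0 = 0)
    (h_fix : ∀ k : ZMod m, k ≠ 0 → ∀ p ∈ α.fixedPts k, ¬ IsRealPt p) :
    ∃ (B' : BaseC → Matrix (Fin 3) (Fin 3) ℂ) (a b c e : BaseC → ℂ),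
      α.IsBlockForm g B' a b c e := by
  have : Fact (1 < m) := ⟨hm⟩
  have hform := X.isRealMatrixGerm_formIn hB.isRealMatrixGerm hB.det_ne_zero
  have h22 : X.formIn B 0 2 2 ≠ 0 := by
    rw [← quadVal_single (X.formIn B 0)]
    exact hB.quadVal_formIn_zero_ne_zero h_zero h_fix (j := 1) (by simp) (by simp)
      (by rw [Pi.star_single, star_one]) (by rw [fibRot_mulVec_single_two, one_smul])
  set D := fun s => (X.formIn B s 2 2)⁻¹ • X.formIn B s
  have hD : IsRealMatrixGerm D := .smul ((hform 2 2).inv h22) hform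
  have hD22 : ∀ᶠ s in 𝓝 (0 : BaseC), D s 2 2 = 1 :=
    ((hform 2 2).eventually_ne h22).mono fun s hs => inv_mul_cancel₀ hs
  have hD_inv := hB.transpose_fibRot_mul_mul_fibRot h_zero (hD22.mono fun s hs => ⟨hs, _, rfl⟩)
  have hT_det : ∀ s, (shear (D s 2 0) (D s 2 1)).det ≠ 0 := fun s => by simp [det_shear]
  refine ⟨fun s => shear (D s 2 0) (D s 2 1) * B s, fun s => D s 0 0 - D s 2 0 * D s 2 0,
    fun s => D s 0 1 - D s 2 0 * D s 2 1, fun s => D s 1 1 - D s 2 1 * D s 2 1, _,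
    hB.mul (isRealMatrixGerm_shear (hD 2 0) (hD 2 1)) (hT_det 0)
      fun j => (hD_inv j).mono fun s hs => shear_mul_fibRot hs,
    (hD 0 0).sub ((hD 2 0).mul (hD 2 0)), (hD 0 1).sub ((hD 2 0).mul (hD 2 1)),
    (hD 1 1).sub ((hD 2 1).mul (hD 2 1)), (hform 2 2).inv h22, inv_ne_zero h22, ?_⟩
  filter_upwards [X.eventually_mem, hD22] with s hs hs22
  rw [X.formIn_mul, ← Matrix.smul_mul, ← Matrix.mul_smul]
  nth_rw 1 [← transpose_inv_mul_mul_inv (M := blockForm _ _ _) (hT_det s).isUnit,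
    transpose_shear_mul_blockForm_mul_shear ((X.isSymm_formIn hs).smul _) hs22]

namespace IsBlockForm

variable {a b c e : BaseC → ℂ}

lemma quadVal_eq (H : α.IsBlockForm g B a b c e) : ∀ᶠ s in 𝓝 (0 : BaseC), ∀ v,
    quadVal (blockForm (a s) (b s) (c s)) (B s *ᵥ v) = e s * quadVal (X.Q s) v := by
  filter_upwards [H.equation, H.eventually_det_ne_zero] with s hs hdet v
  rw [hs, quadVal_smul_left, X.quadVal_formIn_mulVec hdet]

lemma invariant (H : α.IsBlockForm g B a b c e) (h_zero : ∀ k, α.σ k 0 = 0) (j : ℕ) :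
    ∀ᶠ s in 𝓝 (0 : BaseC), (fibRot m j)ᵀ * blockForm (a (α.σ (j * g) s)) (b (α.σ (j * g) s))
      (c (α.σ (j * g) s)) * fibRot m j = blockForm (a s) (b s) (c s) :=
  H.toIsLinearFrame.transpose_fibRot_mul_mul_fibRot h_zero
    (D := fun s => blockForm (a s) (b s) (c s)) (H.equation.mono fun _ hs => ⟨rfl, _, hs⟩) j

end IsBlockForm

end ConicBundleAction

section RealBinaryForms

lemma exists_zero_of_discr_nonpos {a b c : ℝ} (h : a * c - b ^ 2 ≤ 0) :
    ∃ x y : ℝ, (x ≠ 0 ∨ y ≠ 0) ∧ a * x ^ 2 + 2 * b * x * y + c * y ^ 2 = 0 := by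
  by_cases ha : a = 0
  · exact ⟨1, 0, Or.inl one_ne_zero, by simp [ha]⟩
  · refine ⟨-b + √(b ^ 2 - a * c), a, Or.inr ha, ?_⟩
    have hsq := Real.sq_sqrt (show 0 ≤ b ^ 2 - a * c by linarith)
    linear_combination a * hsq

lemma neg_of_discr_pos_of_zero {a b c x y z : ℝ} (hd : 0 < a * c - b ^ 2)
    (h0 : x ≠ 0 ∨ y ≠ 0 ∨ z ≠ 0) (h : z ^ 2 + a * x ^ 2 + 2 * b * x * y + c * y ^ 2 = 0) :
    a < 0 := by
  by_contra! ha
  have ha' : 0 < a := ha.lt_of_ne fun h => by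
    rw [← h] at hd
    linarith [sq_nonneg b]
  have hsum : a * z ^ 2 + (a * x + b * y) ^ 2 + (a * c - b ^ 2) * y ^ 2 = 0 := by
    linear_combination a * h
  have hz_nonneg : 0 ≤ a * z ^ 2 := by positivity
  have hy_nonneg : 0 ≤ (a * c - b ^ 2) * y ^ 2 := by positivity
  have hx_nonneg := sq_nonneg (a * x + b * y)
  have hz : z = 0 := by
    simpa [ha'.ne'] using show a * z ^ 2 = 0 by linarith
  have hy : y = 0 := by
    simpa [hd.ne'] using show (a * c - b ^ 2) * y ^ 2 = 0 by linarith
  have hx : x = 0 := by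
    simpa [hy, ha'.ne'] using show (a * x + b * y) ^ 2 = 0 by linarith
  simp [hx, hy, hz] at h0

end RealBinaryForms

section FibreRotations

lemma fibRot_add_self {r : ℕ} (hr : r ≠ 0) :
    fibRot (r + r) r = !![-1, 0, 0; 0, -1, 0; 0, 0, 1] := by
  have h : 2 * Real.pi * (r : ℝ) / ((r + r : ℕ) : ℝ) = Real.pi := by
    have : (r : ℝ) ≠ 0 := by exact_mod_cast hr
    push_cast
    field_simp
    ring
  simp only [fibRot, h]
  simp

variable {z a b c a' b' c' : ℂ}

lemma transpose_axisRot_mul_blockForm_mul_axisRot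
    (h : (complexify (axisRot z))ᵀ * blockForm a b c * complexify (axisRot z) =
      blockForm a' b' c') :
    (z.re ^ 2 * a - 2 * z.re * z.im * b + z.im ^ 2 * c : ℂ) = a' ∧
      (z.re * z.im * a + (z.re ^ 2 - z.im ^ 2) * b - z.re * z.im * c : ℂ) = b' ∧
      (z.im ^ 2 * a + 2 * z.re * z.im * b + z.re ^ 2 * c : ℂ) = c' := by
  rw [complexify_axisRot] at h
  have h00 := congrFun (congrFun h 0) 0
  have h01 := congrFun (congrFun h 0) 1
  have h11 := congrFun (congrFun h 1) 1
  simp only [blockForm, Matrix.mul_apply, Matrix.transpose_apply, Matrix.of_apply, Matrix.cons_val',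
    Matrix.cons_val_zero, Matrix.cons_val_one, Matrix.cons_val_fin_one, Matrix.cons_val,
    Fin.isValue, Fin.sum_univ_three, zero_mul, mul_zero, add_zero] at h00 h01 h11
  exact ⟨by linear_combination h00, by linear_combination h01, by linear_combination h11⟩

lemma ofReal_re_sq_add_im_sq (hz : ‖z‖ = 1) : (z.re ^ 2 + z.im ^ 2 : ℂ) = 1 := by
  have h := Complex.sq_norm z
  rw [hz, Complex.normSq_apply] at h
  exact_mod_cast (by linear_combination -h : z.re ^ 2 + z.im ^ 2 = 1)

lemma eq_of_axisRot_invariant (hz : ‖z‖ = 1) (hz_im : z.im ≠ 0)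
    (h : (complexify (axisRot z))ᵀ * blockForm a b c * complexify (axisRot z) =
      blockForm a b c) : b = 0 ∧ a = c := by
  obtain ⟨ha, hb, -⟩ := transpose_axisRot_mul_blockForm_mul_axisRot h
  have hpq := ofReal_re_sq_add_im_sq hz
  have hq : (z.im : ℂ) ≠ 0 := by exact_mod_cast hz_im
  generalize (z.re : ℂ) = p, (z.im : ℂ) = q at ha hb hpq hq
  have hca : q * (c - a) = 2 * p * b := mul_left_cancel₀ hq (by linear_combination ha - a * hpq)
  have hac : p * (a - c) = 2 * q * b := mul_left_cancel₀ hq (by linear_combination hb - b * hpq)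
  exact ⟨by linear_combination (-b) * hpq - p / 2 * hca - q / 2 * hac,
    by linear_combination (c - a) * hpq + p * hac - q * hca⟩

end FibreRotations

/-- By Hilbert 90 for `ℂ/ℝ`. -/
lemma exists_smul_star_eq {v : FibC} (h : ∃ c : ℂ, star v = c • v) :
    ∃ l : ℂ, l ≠ 0 ∧ star (l • v) = l • v := by
  obtain ⟨c, hc⟩ := h
  by_cases hc1 : 1 + c = 0
  · refine ⟨Complex.I, Complex.I_ne_zero, ?_⟩
    rw [star_smul, hc, eq_neg_of_add_eq_zero_right hc1]
    simp
  · have hnorm : (star c * c) • v = v := by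
      rw [mul_smul, ← hc, ← star_smul, ← hc, star_star]
    refine ⟨1 + c, hc1, ?_⟩
    rw [star_smul, hc, smul_smul, star_add, star_one, add_mul, one_mul, add_smul, hnorm, add_smul,
      one_smul, add_comm]

namespace ConicBundleAction.IsBlockForm

variable {X : RealConicBundle} {m : ℕ} {α : ConicBundleAction X m} {g : (ZMod m)ˣ}
  {B : BaseC → Matrix (Fin 3) (Fin 3) ℂ} {a b c e : BaseC → ℂ}

lemma quadVal_ofReal (H : α.IsBlockForm g B a b c e) (x y z : ℝ) :
    quadVal (blockForm (a 0) (b 0) (c 0)) ![(x : ℂ), (y : ℂ), (z : ℂ)] =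
      (z ^ 2 + (a 0).re * x ^ 2 + 2 * (b 0).re * x * y + (c 0).re * y ^ 2 : ℝ) := by
  rw [quadVal_blockForm]
  nth_rw 1 [← H.isRealGerm_a.ofReal_re, ← H.isRealGerm_b.ofReal_re, ← H.isRealGerm_c.ofReal_re]
  simp

lemma quadVal_zero_ne_zero (H : α.IsBlockForm g B a b c e) (h_zero : ∀ k, α.σ k 0 = 0)
    (h_fix : ∀ k : ZMod m, k ≠ 0 → ∀ p ∈ α.fixedPts k, ¬ IsRealPt p) {j : ℕ}
    (hj : (j : ZMod m) ≠ 0) {v : FibC} (hv : v ≠ 0) (hv_real : star v = v) {l : ℂ}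
    (hl : fibRot m j *ᵥ v = l • v) : quadVal (blockForm (a 0) (b 0) (c 0)) v ≠ 0 := by
  rw [H.equation.self_of_nhds, quadVal_smul_left]
  exact mul_ne_zero H.e_ne_zero
    (H.quadVal_formIn_zero_ne_zero h_zero h_fix hj hv hv_real hl)

lemma eq_at_zero [NeZero m] (H : α.IsBlockForm g B a b c e) (h_zero : ∀ k, α.σ k 0 = 0)
    (hm : ¬ m ∣ 2) : b 0 = 0 ∧ a 0 = c 0 := by
  have hinv := (H.invariant h_zero 1).self_of_nhds
  rw [h_zero, fibRot_eq_complexify] at hinv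
  exact eq_of_axisRot_invariant (norm_stdRoot_pow m 1)
    (fun h => hm (by simpa using dvd_two_mul_of_im_stdRoot_pow_eq_zero h)) hinv

/-- The element of order two fixes the points of the line `z = 0`. -/
lemma discr_pos_of_even [NeZero m] (H : α.IsBlockForm g B a b c e) (h_zero : ∀ k, α.σ k 0 = 0)
    (h_fix : ∀ k : ZMod m, k ≠ 0 → ∀ p ∈ α.fixedPts k, ¬ IsRealPt p) (hm : Even m) :
    0 < (a 0).re * (c 0).re - (b 0).re ^ 2 := by
  by_contra! hneg
  obtain ⟨x, y, hxy, h⟩ := exists_zero_of_discr_nonpos hneg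
  obtain ⟨r, rfl⟩ := hm
  have hr : r ≠ 0 := fun hr => NeZero.ne (r + r) (by simp [hr])
  have hr' : (r : ZMod (r + r)) ≠ 0 := fun h =>
    absurd (Nat.le_of_dvd (by lia) ((ZMod.natCast_eq_zero_iff _ _).1 h)) (by lia)
  refine H.quadVal_zero_ne_zero (v := ![(x : ℂ), (y : ℂ), ((0 : ℝ) : ℂ)]) (l := -1) h_zero h_fix hr'
    ?_ ?_ ?_ ?_
  · intro h
    have hx := congrFun h 0
    have hy := congrFun h 1
    simp at hx hy
    tauto
  · ext i
    fin_cases i <;> simp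
  · rw [fibRot_add_self hr]
    ext i
    fin_cases i <;> simp [Matrix.mulVec, dotProduct, Fin.sum_univ_three]
  · rw [H.quadVal_ofReal, Complex.ofReal_eq_zero]
    linarith

lemma exists_real_zero (H : α.IsBlockForm g B a b c e)
    (h_real : ∃ p ∈ X.total, p.2 = 0 ∧ IsRealPt p) :
    ∃ x y z : ℝ, (x ≠ 0 ∨ y ≠ 0 ∨ z ≠ 0) ∧
      z ^ 2 + (a 0).re * x ^ 2 + 2 * (b 0).re * x * y + (c 0).re * y ^ 2 = 0 := by
  obtain ⟨⟨v, s⟩, ⟨hv, -, hq⟩, rfl, -, hv_real⟩ := h_real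
  obtain ⟨l, hl0, hl⟩ := exists_smul_star_eq hv_real
  have hlv : l • v ≠ 0 := smul_ne_zero hl0 hv
  have hzero : quadVal (blockForm (a 0) (b 0) (c 0)) (B 0 *ᵥ (l • v)) = 0 := by
    rw [H.quadVal_eq.self_of_nhds, quadVal_smul_right, show quadVal (X.Q 0) v = 0 from hq,
      mul_zero, mul_zero]
  set u := B 0 *ᵥ (l • v) with hu
  have hu_ne : u ≠ 0 := fun h =>
    H.det_ne_zero (Matrix.exists_mulVec_eq_zero_iff.1 ⟨_, hlv, h⟩)
  have hu_re : u = ![((u 0).re : ℂ), ((u 1).re : ℂ), ((u 2).re : ℂ)] := by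
    have hre : ∀ i, ((u i).re : ℂ) = u i := fun i =>
      Complex.conj_eq_iff_re.1 (congrFun (H.isRealMatrixGerm.star_mulVec_zero hl) i)
    ext i
    fin_cases i <;> exact (hre _).symm
  refine ⟨(u 0).re, (u 1).re, (u 2).re, ?_, ?_⟩
  · by_contra! h
    refine hu_ne ?_
    rw [hu_re, h.1, h.2.1, h.2.2]
    simp
  · rwa [hu_re, H.quadVal_ofReal, Complex.ofReal_eq_zero] at hzero

lemma central_fibre (H : α.IsBlockForm g B a b c e) (h_zero : ∀ k, α.σ k 0 = 0) (hm : 1 < m)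
    (h_real : ∃ p ∈ X.total, p.2 = 0 ∧ IsRealPt p)
    (h_fix : ∀ k : ZMod m, k ≠ 0 → ∀ p ∈ α.fixedPts k, ¬ IsRealPt p) :
    ((a 0).re < 0 ∧ 0 < (a 0).re * (c 0).re - (b 0).re ^ 2) ∨
      (Odd m ∧ a 0 = 0 ∧ b 0 = 0 ∧ c 0 = 0) := by
  have : NeZero m := ⟨by lia⟩
  obtain ⟨x, y, z, h0, hxyz⟩ := H.exists_real_zero h_real
  rcases Nat.even_or_odd m with h_even | h_odd
  · have hd := H.discr_pos_of_even h_zero h_fix h_even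
    exact Or.inl ⟨neg_of_discr_pos_of_zero hd h0 hxyz, hd⟩
  · have hm2 : ¬ m ∣ 2 := fun h => hm.ne' ((Nat.coprime_two_right.2 h_odd).eq_one_of_dvd h)
    obtain ⟨hb, hac⟩ := H.eq_at_zero h_zero hm2
    by_cases ha : a 0 = 0
    · exact Or.inr ⟨h_odd, ha, hb, hac ▸ ha⟩
    · have ha_re : (a 0).re ≠ 0 := fun h =>
        ha (by rw [← H.isRealGerm_a.ofReal_re, h, Complex.ofReal_zero])
      have hd : 0 < (a 0).re * (c 0).re - (b 0).re ^ 2 := by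
        rw [hb, ← hac, Complex.zero_re]
        simpa using mul_self_pos.2 ha_re
      exact Or.inl ⟨neg_of_discr_pos_of_zero hd h0 hxyz, hd⟩

end ConicBundleAction.IsBlockForm

section RealJacobians

variable {n : Type*} [Fintype n] {f φ : (n → ℂ) → n → ℂ}

lemma IsRealGerm.fderiv_star (hf : IsRealGerm f) (v : n → ℂ) :
    fderiv ℂ f 0 (star v) = star (fderiv ℂ f 0 v) := by
  have hf_real : HasFDerivAt f ((fderiv ℂ f 0).restrictScalars ℝ) 0 :=
    hf.1.differentiableAt.hasFDerivAt.restrictScalars ℝ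
  have hstar (x : n → ℂ) : HasFDerivAt (fun s : n → ℂ => star s)
      (starL' ℝ : (n → ℂ) ≃L[ℝ] (n → ℂ)).toContinuousLinearMap x :=
    (starL' ℝ : (n → ℂ) ≃L[ℝ] (n → ℂ)).hasFDerivAt
  have hright : HasFDerivAt (fun s => f (star s)) _ 0 :=
    HasFDerivAt.comp (0 : n → ℂ) (g := f) (by rw [star_zero]; exact hf_real) (hstar 0)
  have hleft : HasFDerivAt (fun s => star (f s)) _ 0 := (hstar (f 0)).comp (0 : n → ℂ) hf_real
  simpa using (DFunLike.congr_fun ((hleft.congr_of_eventuallyEq hf.2).unique hright) v).symm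

variable [DecidableEq n] {M N : Matrix n n ℝ}

/-- The derivative of `f` at `0` is the linear map with the real matrix `N`. -/
def HasRealJacobian (f : (n → ℂ) → n → ℂ) (N : Matrix n n ℝ) : Prop :=
  HasFDerivAt f (complexify N).mulVecLin.toContinuousLinearMap 0

namespace HasRealJacobian

lemma unique (hM : HasRealJacobian f M) (hN : HasRealJacobian f N) : M = N :=
  complexify_injective <| Matrix.toLin'.injective <|
    LinearMap.toContinuousLinearMap.injective (HasFDerivAt.unique hM hN)

lemma congr (hN : HasRealJacobian f N) (h : φ =ᶠ[𝓝 0] f) : HasRealJacobian φ N :=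
  HasFDerivAt.congr_of_eventuallyEq hN h

lemma comp (hφ : HasRealJacobian φ M) (hf : HasRealJacobian f N) (h0 : f 0 = 0) :
    HasRealJacobian (fun s => φ (f s)) (M * N) := by
  have h := HasFDerivAt.comp (0 : n → ℂ) (g := φ) (f := f) (by rw [h0]; exact hφ) hf
  refine h.congr_fderiv ?_
  ext1 v
  simp [Matrix.mulVec_mulVec]

lemma mulVec (hf : HasRealJacobian f N) (K : Matrix n n ℝ) :
    HasRealJacobian (fun s => complexify K *ᵥ f s) (K * N) := by
  have h := (complexify K).mulVecLin.toContinuousLinearMap.hasFDerivAt.comp (0 : n → ℂ) hf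
  refine h.congr_fderiv ?_
  ext1 v
  simp [Matrix.mulVec_mulVec]

lemma sum {ι : Type*} (t : Finset ι) {f : ι → (n → ℂ) → n → ℂ} {N : ι → Matrix n n ℝ}
    (h : ∀ i ∈ t, HasRealJacobian (f i) (N i)) :
    HasRealJacobian (fun s => ∑ i ∈ t, f i s) (∑ i ∈ t, N i) := by
  refine (HasFDerivAt.fun_sum h).congr_fderiv ?_
  ext1 v
  simp

end HasRealJacobian

lemma hasRealJacobian_id : HasRealJacobian (fun s : n → ℂ => s) 1 := by
  refine (hasFDerivAt_id (𝕜 := ℂ) (0 : n → ℂ)).congr_fderiv ?_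
  ext1 v
  simp

lemma IsRealGerm.exists_hasRealJacobian (hf : IsRealGerm f) : ∃ N, HasRealJacobian f N := by
  set M := LinearMap.toMatrix' (fderiv ℂ f 0 : (n → ℂ) →ₗ[ℂ] n → ℂ)
  have hM (v : n → ℂ) : M *ᵥ v = fderiv ℂ f 0 v := LinearMap.toMatrix'_mulVec _ v
  have hM_real : complexify (M.map Complex.re) = M := by
    ext i j
    have h := congrFun (hf.fderiv_star (Pi.single j 1)) i
    rw [Pi.star_single, star_one, Pi.star_apply, ← hM, Matrix.mulVec_single_one] at h
    exact Complex.conj_eq_iff_re.1 h.symm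
  refine ⟨M.map Complex.re, hf.1.differentiableAt.hasFDerivAt.congr_fderiv ?_⟩
  ext1 v
  rw [hM_real]
  exact (hM v).symm

/-- `φ` is a real holomorphic coordinate system at the origin. -/
structure IsCoord (φ : (n → ℂ) → n → ℂ) : Prop where
  isRealGerm : IsRealGerm φ
  map_zero : φ 0 = 0
  exists_hasRealJacobian : ∃ N : Matrix n n ℝ, N.det ≠ 0 ∧ HasRealJacobian φ N

namespace IsCoord

lemma exists_homeomorph (hφ : IsCoord φ) : ∃ ψ : OpenPartialHomeomorph (n → ℂ) (n → ℂ),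
    ⇑ψ = φ ∧ 0 ∈ ψ.source ∧ AnalyticAt ℂ ψ.symm 0 := by
  obtain ⟨N, hN_det, hN⟩ := hφ.exists_hasRealJacobian
  have hN_unit : IsUnit (complexify N) :=
    ((Matrix.isUnit_iff_isUnit_det N).2 hN_det.isUnit).map complexify
  let L : (n → ℂ) ≃L[ℂ] (n → ℂ) :=
    (Matrix.toLinearEquiv' _ hN_unit.invertible).toContinuousLinearEquiv
  have hL : HasFDerivAt φ (L : (n → ℂ) →L[ℂ] (n → ℂ)) 0 := hN
  have hs : HasStrictFDerivAt φ (L : (n → ℂ) →L[ℂ] (n → ℂ)) 0 :=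
    hL.fderiv ▸ hφ.isRealGerm.1.hasStrictFDerivAt
  have hmem := hs.mem_toOpenPartialHomeomorph_source
  refine ⟨hs.toOpenPartialHomeomorph φ, rfl, hmem, ?_⟩
  simpa only [HasStrictFDerivAt.toOpenPartialHomeomorph_coe, hφ.map_zero] using
    (hs.toOpenPartialHomeomorph φ).analyticAt_symm' (i := L) hmem hφ.isRealGerm.1 hL.fderiv

lemma mulVec (hφ : IsCoord φ) {K : Matrix n n ℝ} (hK : K.det ≠ 0) :
    IsCoord fun s => complexify K *ᵥ φ s := by
  obtain ⟨N, hN_det, hN⟩ := hφ.exists_hasRealJacobian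
  exact ⟨(IsRealMatrixGerm.complexify K).mulVec hφ.isRealGerm,
    by rw [hφ.map_zero, Matrix.mulVec_zero], K * N,
    by rw [Matrix.det_mul]; exact mul_ne_zero hK hN_det, hN.mulVec K⟩

/-- `σ` fixes the points of a curve that is a line in the coordinates `φ`. -/
lemma frequently_eq_self_of_linearizes (hφ : IsCoord φ) {σ : (n → ℂ) → n → ℂ}
    (hσ : Tendsto σ (𝓝 0) (𝓝 0)) (hN : ∀ᶠ s in 𝓝 0, φ (σ s) = complexify N *ᵥ φ s)
    (hdet : (N - 1).det = 0) : ∃ᶠ s in 𝓝[≠] 0, σ s = s := by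
  obtain ⟨w, hw, hNw⟩ : ∃ w ≠ 0, complexify N *ᵥ w = w := by
    have h : (complexify N - 1).det = 0 := by
      rw [← map_one complexify, ← map_sub, det_complexify, hdet, Complex.ofReal_zero]
    simpa only [Matrix.sub_mulVec, Matrix.one_mulVec, sub_eq_zero] using
      Matrix.exists_mulVec_eq_zero_iff.2 h
  obtain ⟨ψ, rfl, hψ_source, hψ_symm⟩ := hφ.exists_homeomorph
  have hψ_symm_zero : ψ.symm 0 = 0 := by
    simpa only [hφ.map_zero] using ψ.left_inv hψ_source
  have h_source : ∀ᶠ s in 𝓝 0, s ∈ ψ.source := ψ.open_source.mem_nhds hψ_source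
  have h_line : Tendsto (fun t : ℂ => t • w) (𝓝[≠] 0) (𝓝 0) := by
    have h : ContinuousAt (fun t : ℂ => t • w) 0 := by fun_prop
    simpa using h.tendsto.mono_left nhdsWithin_le_nhds
  have h_curve : Tendsto (fun t : ℂ => ψ.symm (t • w)) (𝓝[≠] 0) (𝓝 0) := by
    simpa only [hψ_symm_zero, Function.comp_def] using hψ_symm.continuousAt.tendsto.comp h_line
  have h_right : ∀ᶠ t : ℂ in 𝓝[≠] 0, ψ (ψ.symm (t • w)) = t • w := by
    have h_target : ψ.target ∈ 𝓝 0 := hφ.map_zero ▸ ψ.open_target.mem_nhds (ψ.map_source hψ_source)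
    exact (h_line.eventually h_target).mono fun t ht => ψ.right_inv ht
  have h_ne : ∀ᶠ t : ℂ in 𝓝[≠] 0, ψ.symm (t • w) ≠ 0 := by
    filter_upwards [h_right, self_mem_nhdsWithin] with t ht ht0 h0
    rw [h0, hφ.map_zero] at ht
    exact smul_ne_zero ht0 hw ht.symm
  refine (tendsto_nhdsWithin_iff.2 ⟨h_curve, h_ne⟩).frequently (Eventually.frequently ?_)
  filter_upwards [h_right, h_curve.eventually hN, h_curve.eventually (hσ.eventually h_source),
    h_curve.eventually h_source] with t ht htN h_source_σ h_source
  refine ψ.injOn h_source_σ h_source ?_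
  rw [htN, ht, Matrix.mulVec_smul, hNw]

end IsCoord

end RealJacobians

lemma injective_of_det_sub_one_ne_zero {G n : Type*} [Group G] [Fintype n] [DecidableEq n]
    [Nonempty n] {ρ : G →* Matrix n n ℝ} (h : ∀ g, g ≠ 1 → (ρ g - 1).det ≠ 0) :
    Function.Injective ρ := by
  refine (injective_iff_map_eq_one ρ).2 fun g hg => by_contra fun hg_ne => h g hg_ne ?_
  rw [hg, sub_self, Matrix.det_zero]

section FixedVectors

lemma exists_continuousAt_isotropic {E : Type*} [NormedAddCommGroup E] [NormedSpace ℂ E]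
    [StarAddMonoid E] {a b c : E → ℂ} (ha : IsRealGerm a) (hb : IsRealGerm b) (hc : IsRealGerm c)
    (hd : 0 < (a 0).re * (c 0).re - (b 0).re ^ 2) :
    ∃ v : E → FibC, ContinuousAt v 0 ∧ ∀ᶠ s in 𝓝 0, v s ≠ 0 ∧ v s 2 = 0 ∧
      quadVal (blockForm (a s) (b s) (c s)) (v s) = 0 := by
  have ha0 : a 0 ≠ 0 := fun h => by
    rw [h, Complex.zero_re, zero_mul, zero_sub] at hd
    linarith [sq_nonneg (b 0).re]
  have hδ0 : 0 < (a 0 * c 0 - b 0 ^ 2).re := by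
    rw [← ha.ofReal_re, ← hb.ofReal_re, ← hc.ofReal_re]
    exact_mod_cast hd
  obtain ⟨r, hr, hr_sq⟩ := ((ha.mul hc).sub (hb.pow 2)).exists_pow_eq_of_pos hδ0 two_ne_zero
  refine ⟨fun s => ![-b s + Complex.I * r s, a s, 0], ?_, ?_⟩
  · refine continuousAt_pi.2 fun i => ?_
    fin_cases i
    exacts [hb.1.continuousAt.neg.add (continuousAt_const.mul hr.1.continuousAt),
      ha.1.continuousAt, continuousAt_const]
  · filter_upwards [ha.eventually_ne ha0] with s hs
    refine ⟨fun h => hs (congrFun h 1), rfl, ?_⟩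
    rw [quadVal_blockForm]
    simp only [Matrix.cons_val]
    linear_combination (-a s) * hr_sq s + a s * r s ^ 2 * Complex.I_sq

lemma complexify_axisRot_mulVec_of_im_eq_zero {z : ℂ} (hz : z.im = 0) {v : FibC} (hv : v 2 = 0) :
    complexify (axisRot z) *ᵥ v = z • v := by
  rw [complexify_axisRot, ← Complex.re_add_im z, hz]
  ext i
  fin_cases i <;> simp [Matrix.mulVec, dotProduct, Fin.sum_univ_three, hv]

lemma complexify_axisRot_mulVec_isotropic (z : ℂ) :
    complexify (axisRot z) *ᵥ ![1, Complex.I, 0] = z • ![1, Complex.I, 0] := by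
  rw [complexify_axisRot]
  ext i
  fin_cases i <;> simp [Matrix.mulVec, dotProduct, Fin.sum_univ_three]
  linear_combination Complex.I * Complex.re_add_im z - z.im * Complex.I_sq

end FixedVectors

namespace ConicBundleAction

variable {X : RealConicBundle} {m : ℕ}

variable (α : ConicBundleAction X m) in
/-- `ρ` is the representation on the tangent space of the base at the fixed point `0`. -/
def IsTangentRep (ρ : Multiplicative (ZMod m) →* Matrix (Fin 2) (Fin 2) ℝ) : Prop :=
  ∀ k, HasRealJacobian (α.σ k) (ρ (.ofAdd k))

variable {α : ConicBundleAction X m}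

lemma exists_isTangentRep (h_zero : ∀ k, α.σ k 0 = 0) : ∃ ρ, α.IsTangentRep ρ := by
  choose N hN using fun k => (α.isRealGerm_base k).exists_hasRealJacobian
  have hN_zero : N 0 = 1 := (hN 0).unique <|
    hasRealJacobian_id.congr (X.eventually_mem.mono α.σ_zero)
  have hN_add : ∀ k l, N (k + l) = N k * N l := fun k l => (hN (k + l)).unique <|
    ((hN k).comp (hN l) (h_zero l)).congr (X.eventually_mem.mono (α.σ_add k l))
  exact ⟨⟨⟨fun k => N k.toAdd, hN_zero⟩, fun k l => hN_add k.toAdd l.toAdd⟩, hN⟩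

namespace IsTangentRep

variable {ρ : Multiplicative (ZMod m) →* Matrix (Fin 2) (Fin 2) ℝ}

/-- Averaging `ρ (-k) (σ k s)` over the group. -/
lemma exists_isCoord [NeZero m] (hρ : α.IsTangentRep ρ) (h_zero : ∀ k, α.σ k 0 = 0) :
    ∃ φ, IsCoord φ ∧ ∀ l, ∀ᶠ s in 𝓝 0, φ (α.σ l s) = complexify (ρ (.ofAdd l)) *ᵥ φ s := by
  have hρ_neg : ∀ k, ρ (.ofAdd (-k)) * ρ (.ofAdd k) = 1 := fun k => by
    rw [← map_mul, ← ofAdd_add, neg_add_cancel, ofAdd_zero, map_one]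
  refine ⟨fun s => ∑ k, complexify (ρ (.ofAdd (-k))) *ᵥ α.σ k s,
    ⟨.sum _ fun k _ => (IsRealMatrixGerm.complexify _).mulVec (α.isRealGerm_base k),
      by simp [h_zero], _, ?_, .sum _ fun k _ => (hρ k).mulVec _⟩, fun l => ?_⟩
  · rw [Finset.sum_congr rfl fun k _ => hρ_neg k, Finset.sum_const, Finset.card_univ, ZMod.card,
      ← Nat.cast_smul_eq_nsmul ℝ, Matrix.det_smul, Matrix.det_one, mul_one]
    exact pow_ne_zero _ (NeZero.ne _)
  · filter_upwards [X.eventually_mem] with s hs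
    rw [Matrix.mulVec_sum]
    conv_rhs => rw [← Equiv.sum_comp (Equiv.addRight l)]
    refine Finset.sum_congr rfl fun k _ => ?_
    have hkl : -k = l + -(k + l) := by abel
    rw [Equiv.coe_addRight, α.σ_add k l s hs, Matrix.mulVec_mulVec, ← map_mul, ← map_mul,
      ← ofAdd_add, ← hkl]

lemma det_sub_one_ne_zero [NeZero m] (hρ : α.IsTangentRep ρ) (h_zero : ∀ k, α.σ k 0 = 0)
    {k : ZMod m} (hk : ∀ᶠ s in 𝓝[≠] 0, α.σ k s ≠ s) : (ρ (.ofAdd k) - 1).det ≠ 0 := fun hdet => by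
  obtain ⟨φ, hφ, hφ_lin⟩ := hρ.exists_isCoord h_zero
  exact hφ.frequently_eq_self_of_linearizes ((α.isRealGerm_base k).tendsto_zero (h_zero k))
    (hφ_lin k) hdet hk

lemma exists_base_rotation [NeZero m] (hρ : α.IsTangentRep ρ) (h_zero : ∀ k, α.σ k 0 = 0)
    (hρ_inj : Function.Injective ρ) (g : (ZMod m)ˣ) (hg : (ρ (.ofAdd g) - 1).det ≠ 0) :
    ∃ (b : ℕ) (φ : BaseC → BaseC), b.Coprime m ∧ IsCoord φ ∧
      ∀ᶠ s in 𝓝 0, φ (α.σ g s) = baseRot m b 1 *ᵥ φ s := by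
  obtain ⟨φ, hφ, hφ_lin⟩ := hρ.exists_isCoord h_zero
  obtain ⟨b, P, hb, hP⟩ := exists_coprime_semiconjBy_planeRot hρ_inj g hg
  have hP_det : (P : Matrix (Fin 2) (Fin 2) ℝ).det ≠ 0 :=
    ((Matrix.isUnit_iff_isUnit_det _).1 P.isUnit).ne_zero
  refine ⟨b, _, hb, hφ.mulVec hP_det, ?_⟩
  filter_upwards [hφ_lin g] with s hs
  rw [hs, baseRot_eq_complexify, mul_one, Matrix.mulVec_mulVec, Matrix.mulVec_mulVec, ← map_mul,
    ← map_mul, hP.eq]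

end IsTangentRep

namespace IsBlockForm

variable {g : (ZMod m)ˣ} {B : BaseC → Matrix (Fin 3) (Fin 3) ℂ} {a b c e : BaseC → ℂ}

/-- Where `stdRoot m ^ j = ±1` the fixed points are the zeros of the binary form on the line
`z = 0`, otherwise the point `(1 : i : 0)`. -/
lemma exists_fixed_section [NeZero m] (H : α.IsBlockForm g B a b c e) (h_zero : ∀ k, α.σ k 0 = 0)
    (h_even : Even m → 0 < (a 0).re * (c 0).re - (b 0).re ^ 2) {j : ℕ} (hj : ¬ m ∣ j) :
    ∃ (v : BaseC → FibC) (l : ℂ), ContinuousAt v 0 ∧ ∀ᶠ s in 𝓝 0, α.σ (j * g) s = s →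
      v s ≠ 0 ∧ fibRot m j *ᵥ v s = l • v s ∧ quadVal (blockForm (a s) (b s) (c s)) (v s) = 0 := by
  by_cases h_im : (stdRoot m ^ j).im = 0
  · have hm : Even m := (Nat.even_or_odd m).resolve_right fun h_odd => hj <|
      (Nat.coprime_two_right.2 h_odd).dvd_of_dvd_mul_left
        (dvd_two_mul_of_im_stdRoot_pow_eq_zero h_im)
    obtain ⟨v, hv, hv_zero⟩ := exists_continuousAt_isotropic H.isRealGerm_a H.isRealGerm_b
      H.isRealGerm_c (h_even hm)
    refine ⟨v, stdRoot m ^ j, hv, hv_zero.mono fun s ⟨hs, hs₂, hs_zero⟩ _ => ⟨hs, ?_, hs_zero⟩⟩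
    rw [fibRot_eq_complexify, complexify_axisRot_mulVec_of_im_eq_zero h_im hs₂]
  · refine ⟨fun _ => ![1, Complex.I, 0], stdRoot m ^ j, continuousAt_const, ?_⟩
    filter_upwards [H.invariant h_zero j] with s hs hσ
    rw [hσ, fibRot_eq_complexify] at hs
    obtain ⟨hb, hac⟩ := eq_of_axisRot_invariant (norm_stdRoot_pow m j) h_im hs
    refine ⟨fun h => one_ne_zero (congrFun h 0), ?_, ?_⟩
    · rw [fibRot_eq_complexify, complexify_axisRot_mulVec_isotropic]
    · rw [quadVal_blockForm, hb, hac]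
      simp

lemma eventually_ne_self [NeZero m] (H : α.IsBlockForm g B a b c e) (h_zero : ∀ k, α.σ k 0 = 0)
    (h_even : Even m → 0 < (a 0).re * (c 0).re - (b 0).re ^ 2)
    (h_fix : ∀ k : ZMod m, k ≠ 0 → OnlyIsolatedPts (α.fixedPts k)) {k : ZMod m} (hk : k ≠ 0) :
    ∀ᶠ s in 𝓝[≠] 0, α.σ k s ≠ s := by
  obtain ⟨j, rfl⟩ : ∃ j : ℕ, (j : ZMod m) * g = k :=
    ⟨(k * (g⁻¹ : (ZMod m)ˣ)).val, by
      rw [ZMod.natCast_zmod_val, mul_assoc, Units.inv_mul, mul_one]⟩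
  have hj : ¬ m ∣ j := fun h => hk (by rw [(ZMod.natCast_eq_zero_iff j m).2 h, zero_mul])
  obtain ⟨v, l, hv_cont, hv⟩ := H.exists_fixed_section h_zero h_even hj
  have h_cont : ContinuousAt (fun s => ((B s)⁻¹ *ᵥ v s, s)) 0 := by
    have hB_inv : ContinuousAt (fun s => (B s)⁻¹) 0 := continuousAt_pi.2 fun i =>
      continuousAt_pi.2 fun i' => (H.isRealMatrixGerm.inv H.det_ne_zero i i').1.continuousAt
    exact ((continuous_fst.matrix_mulVec continuous_snd).continuousAt.comp₂ hB_inv hv_cont).prodMk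
      continuousAt_id
  have h_mem : ∀ᶠ s in 𝓝 0, α.σ (j * g) s = s → ((B s)⁻¹ *ᵥ v s, s) ∈ α.fixedPts (j * g) := by
    filter_upwards [hv, H.eventually_mem_fixedPts j, H.equation,
      H.isRealGerm_e.eventually_ne H.e_ne_zero] with s hs hs_mem hs_eq he hσ
    obtain ⟨hv_ne, hvl, hv_zero⟩ := hs hσ
    refine hs_mem hσ _ l hv_ne hvl ?_
    rw [hs_eq, quadVal_smul_left] at hv_zero
    exact (mul_eq_zero.1 hv_zero).resolve_left he
  obtain ⟨U, hU, h_iso⟩ := h_fix _ hk _ (h_mem.self_of_nhds (h_zero _))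
  filter_upwards [nhdsWithin_le_nhds (h_cont.eventually hU), nhdsWithin_le_nhds h_mem,
    self_mem_nhdsWithin] with s hs_U hs_mem hs_ne hσ
  exact hs_ne (h_iso _ ⟨hs_U, hs_mem hσ⟩).1

end IsBlockForm

end ConicBundleAction

section VanishesTwice

variable {E F : Type*} [NormedAddCommGroup E] [NormedSpace ℂ E] [NormedAddCommGroup F]
  [NormedSpace ℂ F] {f h : E → ℂ} {p : E}

/-- `f` vanishes at `p` to order at least two. -/
structure VanishesTwice (f : E → ℂ) (p : E) : Prop where
  eq_zero : f p = 0
  hasFDerivAt : HasFDerivAt f (0 : E →L[ℂ] ℂ) p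

namespace VanishesTwice

lemma add (hf : VanishesTwice f p) (hh : VanishesTwice h p) :
    VanishesTwice (fun x => f x + h x) p :=
  ⟨by rw [hf.eq_zero, hh.eq_zero, add_zero],
    (hf.hasFDerivAt.add hh.hasFDerivAt).congr_fderiv (add_zero 0)⟩

lemma mul (hf : f p = 0) (hf' : DifferentiableAt ℂ f p) (hh : h p = 0)
    (hh' : DifferentiableAt ℂ h p) : VanishesTwice (fun x => f x * h x) p := by
  refine ⟨by rw [hf, zero_mul], (hf'.hasFDerivAt.mul hh'.hasFDerivAt).congr_fderiv ?_⟩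
  ext v
  simp [hf, hh]

lemma mul_left (hf : VanishesTwice f p) (hh : DifferentiableAt ℂ h p) :
    VanishesTwice (fun x => h x * f x) p := by
  refine ⟨by rw [hf.eq_zero, mul_zero], (hh.hasFDerivAt.mul hf.hasFDerivAt).congr_fderiv ?_⟩
  ext v
  simp [hf.eq_zero]

lemma comp {u : F → E} {q : F} (hf : VanishesTwice f (u q)) (hu : DifferentiableAt ℂ u q) :
    VanishesTwice (fun x => f (u x)) q :=
  ⟨hf.eq_zero, (hf.hasFDerivAt.comp q hu.hasFDerivAt).congr_fderiv
    (ContinuousLinearMap.zero_comp _)⟩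

lemma congr (hf : VanishesTwice f p) (h_eq : h =ᶠ[𝓝 p] f) : VanishesTwice h p :=
  ⟨h_eq.eq_of_nhds.trans hf.eq_zero, hf.hasFDerivAt.congr_of_eventuallyEq h_eq⟩

end VanishesTwice

end VanishesTwice

section VanishingOrder

variable {E : Type*} [NormedAddCommGroup E] [NormedSpace ℂ E]

lemma isBigO_norm_of_analyticAt {f : E → ℂ} (hf : AnalyticAt ℂ f 0) (h0 : f 0 = 0) :
    f =O[𝓝 0] fun s => ‖s‖ ^ 1 := by
  simpa [h0] using hf.differentiableAt.isBigO_sub.norm_right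

lemma VanishesTwice.isBigO_norm_sq {f : E → ℂ} (hf' : VanishesTwice f 0) (hf : AnalyticAt ℂ f 0) :
    f =O[𝓝 0] fun s => ‖s‖ ^ 2 := by
  obtain ⟨p, hp⟩ := hf
  have hp_one (y : E) : p 1 (fun _ => y) = 0 := by
    rw [← Matrix.vec_single_eq_const y]
    simpa using congrArg (fun L => L y) (hp.fderiv_eq.symm.trans hf'.hasFDerivAt.fderiv)
  have h_partial (y : E) : p.partialSum 2 y = 0 := by
    rw [FormalMultilinearSeries.partialSum, Finset.sum_range_succ, Finset.sum_range_one, hp_one,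
      hp.coeff_zero, hf'.eq_zero, add_zero]
  simpa only [zero_add, h_partial, sub_zero] using hp.isBigO_sub_partialSum_pow 2

lemma isBigO_comp_symm {F : Type*} [NormedAddCommGroup F] [NormedSpace ℂ F]
    {ψ : OpenPartialHomeomorph E F} (h_source : 0 ∈ ψ.source) (h0 : ψ 0 = 0)
    (hψ : DifferentiableAt ℂ ψ.symm 0) {f : E → ℂ} {i : ℕ} (hf : f =O[𝓝 0] fun s => ‖s‖ ^ i) :
    (fun w => f (ψ.symm w)) =O[𝓝 0] fun w => ‖w‖ ^ i := by
  have h_symm : ψ.symm 0 = 0 := by simpa only [h0] using ψ.left_inv h_source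
  have h_tendsto : Tendsto ψ.symm (𝓝 0) (𝓝 0) := by
    simpa only [h_symm] using hψ.continuousAt.tendsto
  have h_lin : ψ.symm =O[𝓝 0] fun w => w := by simpa only [h_symm, sub_zero] using hψ.isBigO_sub
  exact (hf.comp_tendsto h_tendsto).trans (h_lin.norm_norm.pow i)

end VanishingOrder

lemma IsRealMatrixGerm.eventually_analyticAt {E ι κ : Type*} [NormedAddCommGroup E]
    [NormedSpace ℂ E] [StarAddMonoid E] [Finite ι] [Finite κ] {M : E → Matrix ι κ ℂ}
    (hM : IsRealMatrixGerm M) :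
    ∀ᶠ s in 𝓝 (0 : E), ∀ i j, AnalyticAt ℂ (fun s => M s i j) s :=
  eventually_all.2 fun i => eventually_all.2 fun j => (hM i j).1.eventually_analyticAt

lemma fibRot_zero (m : ℕ) : fibRot m 0 = 1 := by
  rw [fibRot_eq_complexify, pow_zero, map_one, map_one]

lemma fibRot_succ (m j : ℕ) : fibRot m (j + 1) = fibRot m 1 * fibRot m j := by
  rw [fibRot_eq_complexify, fibRot_eq_complexify, fibRot_eq_complexify, ← map_mul, ← map_mul,
    pow_one, pow_succ']

lemma baseRot_zero (m b : ℕ) : baseRot m b 0 = 1 := by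
  rw [baseRot_eq_complexify, mul_zero, pow_zero, map_one, map_one]

lemma baseRot_succ (m b j : ℕ) : baseRot m b (j + 1) = baseRot m b 1 * baseRot m b j := by
  simp only [baseRot_eq_complexify, ← map_mul, ← pow_add]
  rw [mul_one, mul_add, mul_one, add_comm]

namespace ConicBundleAction

variable {X : RealConicBundle} {m : ℕ} {α : ConicBundleAction X m}

variable (α) in
/-- A set of parameters to which the whole situation can be restricted: it lies in the base of `X`
and is stable under complex conjugation and under the group. -/
structure IsInvariantSet (U : Set BaseC) : Prop where
  subset : U ⊆ X.S
  star_mem : ∀ s ∈ U, star s ∈ U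
  mapsTo : ∀ k, Set.MapsTo (α.σ k) U U

lemma exists_isInvariantSet [NeZero m] (h_zero : ∀ k, α.σ k 0 = 0) {p : BaseC → Prop}
    (hp : ∀ᶠ s in 𝓝 0, p s) :
    ∃ U, IsOpen U ∧ 0 ∈ U ∧ α.IsInvariantSet U ∧ ∀ s ∈ U, p s := by
  obtain ⟨W, hWp, hW, hW0⟩ := eventually_nhds_iff.1 hp
  refine ⟨⋂ k, X.S ∩ α.σ k ⁻¹' (W ∩ star ⁻¹' W), isOpen_iInter_of_finite fun k => ?_,
    Set.mem_iInter.2 fun k => ⟨X.zero_mem, ?_⟩,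
    ⟨fun s hs => (Set.mem_iInter.1 hs 0).1, fun s hs => Set.mem_iInter.2 fun k => ?_,
      fun l s hs => Set.mem_iInter.2 fun k => ?_⟩, fun s hs => ?_⟩
  · exact (α.σ_analytic k).continuousOn.isOpen_inter_preimage X.isOpen_S
      (hW.inter (hW.preimage continuous_star))
  · simp [h_zero, hW0]
  · obtain ⟨hs_S, hs_W, hs_star⟩ := Set.mem_iInter.1 hs k
    refine ⟨X.star_mem s hs_S, ?_⟩
    rw [Set.mem_preimage, α.σ_real k s hs_S]
    exact ⟨hs_star, by rwa [Set.mem_preimage, star_star]⟩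
  · obtain ⟨hs_S, hs_W⟩ := Set.mem_iInter.1 hs (k + l)
    exact ⟨α.σ_mapsTo l hs_S, by rwa [Set.mem_preimage, ← α.σ_add k l s hs_S]⟩
  · obtain ⟨hs_S, hs_W, -⟩ := Set.mem_iInter.1 hs 0
    exact hWp s (α.σ_zero s hs_S ▸ hs_W)

namespace IsInvariantSet

variable {U : Set BaseC} {g : ZMod m}

lemma base_pow (hU : α.IsInvariantSet U) {φ : BaseC → BaseC} {b : ℕ}
    (h : ∀ s ∈ U, φ (α.σ g s) = baseRot m b 1 *ᵥ φ s) (j : ℕ) :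
    ∀ s ∈ U, φ (α.σ (j * g) s) = baseRot m b j *ᵥ φ s := by
  intro s hs
  induction j with
  | zero =>
    rw [Nat.cast_zero, zero_mul, α.σ_zero s (hU.subset hs), baseRot_zero, Matrix.one_mulVec]
  | succ j ih =>
    rw [Nat.cast_succ, add_mul, one_mul, add_comm, α.σ_add _ _ s (hU.subset hs),
      h _ (hU.mapsTo _ hs), ih, Matrix.mulVec_mulVec, ← baseRot_succ]

lemma fibre_pow (hU : α.IsInvariantSet U) {B : BaseC → Matrix (Fin 3) (Fin 3) ℂ}
    (h : ∀ s ∈ U, ∃ c : ℂ, c ≠ 0 ∧ B (α.σ g s) * α.A g s = c • (fibRot m 1 * B s)) (j : ℕ) :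
    ∀ s ∈ U, ∃ c : ℂ, c ≠ 0 ∧ B (α.σ (j * g) s) * α.A (j * g) s = c • (fibRot m j * B s) := by
  intro s hs
  induction j with
  | zero =>
    obtain ⟨c, hc, hA⟩ := α.A_zero s (hU.subset hs)
    refine ⟨c, hc, ?_⟩
    rw [Nat.cast_zero, zero_mul, α.σ_zero s (hU.subset hs), hA, fibRot_zero, Matrix.mul_smul,
      mul_one, one_mul]
  | succ j ih =>
    obtain ⟨c₁, hc₁, hj⟩ := ih
    obtain ⟨c₂, hc₂, hg⟩ := h _ (hU.mapsTo (j * g) hs)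
    obtain ⟨c₃, hc₃, hA⟩ := α.A_add g (j * g) s (hU.subset hs)
    refine ⟨c₃ * c₂ * c₁, mul_ne_zero (mul_ne_zero hc₃ hc₂) hc₁, ?_⟩
    rw [Nat.cast_succ, add_mul, one_mul, add_comm, α.σ_add _ _ s (hU.subset hs), hA,
      Matrix.mul_smul, ← mul_assoc, hg, Matrix.smul_mul, mul_assoc, hj, Matrix.mul_smul,
      ← mul_assoc, ← fibRot_succ, smul_smul, smul_smul, mul_assoc]

end IsInvariantSet

lemma exists_chart [NeZero m] (h_zero : ∀ k, α.σ k 0 = 0) {φ : BaseC → BaseC} (hφ : IsCoord φ)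
    {p : BaseC → Prop} (hp : ∀ᶠ s in 𝓝 0, p s) :
    ∃ ψ : OpenPartialHomeomorph BaseC BaseC, ⇑ψ = φ ∧ 0 ∈ ψ.source ∧
      α.IsInvariantSet ψ.source ∧ AnalyticOnNhd ℂ ψ ψ.source ∧ AnalyticOnNhd ℂ ψ.symm ψ.target ∧
      (∀ s ∈ ψ.source, ψ (star s) = star (ψ s)) ∧ ∀ s ∈ ψ.source, p s := by
  obtain ⟨ψ, rfl, h_source, h_symm⟩ := hφ.exists_homeomorph
  obtain ⟨U, hU_open, hU_zero, hU, hUp⟩ := exists_isInvariantSet h_zero <|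
    (ψ.open_source.eventually_mem h_source).and <|
      hφ.isRealGerm.1.eventually_analyticAt.and <|
      ((hφ.isRealGerm.tendsto_zero hφ.map_zero).eventually h_symm.eventually_analyticAt).and <|
      hφ.isRealGerm.2.and hp
  choose hU_source hU_analytic hU_symm hU_star hU_p using hUp
  have hU_eq : (ψ.restrOpen U hU_open).source = U :=
    (ψ.restrOpen_source U hU_open).trans (Set.inter_eq_right.2 hU_source)
  refine ⟨ψ.restrOpen U hU_open, rfl, ?_, ?_, ?_, ?_, ?_, ?_⟩
  · rwa [hU_eq]
  · rwa [hU_eq]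
  · exact fun s hs => hU_analytic s (hU_eq ▸ hs)
  · intro w hw
    have h_mem : ψ.symm w ∈ U := hU_eq.subset ((ψ.restrOpen U hU_open).map_target hw)
    have h_analytic := hU_symm _ h_mem
    rwa [show ψ (ψ.symm w) = w from (ψ.restrOpen U hU_open).right_inv hw] at h_analytic
  · exact fun s hs => hU_star s (hU_eq ▸ hs)
  · exact fun s hs => hU_p s (hU_eq ▸ hs)

/-- It suffices to bring the equation to the form `N + K` as germs: the matrix `H` is then `K` in
the new coordinates of the base. -/
lemma equivariantlyEquivalent_of_germs [NeZero m] (h_zero : ∀ k, α.σ k 0 = 0) {g : (ZMod m)ˣ}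
    {φ : BaseC → BaseC} (hφ : IsCoord φ) {b : ℕ}
    (hφ_rot : ∀ᶠ s in 𝓝 0, φ (α.σ g s) = baseRot m b 1 *ᵥ φ s)
    {B K : BaseC → Matrix (Fin 3) (Fin 3) ℂ} (hB : α.IsLinearFrame g B) (hK : IsRealMatrixGerm K)
    (hK_symm : ∀ᶠ s in 𝓝 0, (K s).IsSymm) {i : ℕ}
    (hK_order : ∀ j k, (fun s => K s j k) =O[𝓝 0] fun s => ‖s‖ ^ i) {N : BaseC → FibC → ℂ}
    (hN : ∀ᶠ s in 𝓝 0, ∃ c : ℂ, c ≠ 0 ∧ ∀ v,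
      N (φ s) (B s *ᵥ v) + quadVal (K s) (B s *ᵥ v) = c * quadVal (X.Q s) v) :
    EquivariantlyEquivalent α (g : ZMod m) b N i := by
  have hB_lin := hB.linear 1
  simp only [Nat.cast_one, one_mul] at hB_lin
  obtain ⟨ψ, rfl, hψ_zero, hψ_inv, hψ, hψ_symm, hψ_star, hψ_germs⟩ := exists_chart h_zero hφ <|
    hB.isRealMatrixGerm.eventually_analyticAt.and <| hB.isRealMatrixGerm.eventually_star.and <|
    hB.eventually_det_ne_zero.and <| hK.eventually_analyticAt.and <| hK.eventually_star.and <|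
    hK_symm.and <| hN.and <| hφ_rot.and hB_lin
  choose B_analytic B_real B_det K_analytic K_real K_symm eqn base fibre using hψ_germs
  have h_target (w : BaseC) (hw : w ∈ ψ.target) : ψ.symm w ∈ ψ.source := ψ.map_target hw
  have h_star (w : BaseC) (hw : w ∈ ψ.target) : ψ.symm (star w) = star (ψ.symm w) := by
    rw [← ψ.left_inv (hψ_inv.star_mem _ (h_target w hw)), hψ_star _ (h_target w hw),
      ψ.right_inv hw]
  refine ⟨ψ, B, fun w => K (ψ.symm w),
    ⟨hψ_zero, hφ.map_zero, hψ_inv.subset, hψ_inv.star_mem, hψ_inv.mapsTo, hψ, hψ_symm, hψ_star⟩,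
    ⟨fun i j s hs => B_analytic s hs i j, B_real, B_det⟩, ⟨fun i j w hw => ?_, fun w hw => ?_,
      fun w hw => K_symm _ (h_target w hw), fun j k => ?_⟩, fun s hs => ?_,
    fun j s hs => ⟨hψ_inv.base_pow base j s hs, hψ_inv.fibre_pow fibre j s hs⟩⟩
  · exact (K_analytic _ (h_target w hw) i j).fun_comp (hψ_symm w hw)
  · simp only [h_star w hw, K_real _ (h_target w hw)]
  · exact isBigO_comp_symm hψ_zero hφ.map_zero
      (hψ_symm 0 (hφ.map_zero ▸ ψ.map_source hψ_zero)).differentiableAt (hK_order j k)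
  · simpa only [ψ.left_inv hs] using eqn s hs

end ConicBundleAction

section SquareRoots

lemma exists_sqrt_of_neg {a b c : ℝ} (ha : a < 0) (hd : 0 < a * c - b ^ 2) :
    ∃ x y w : ℝ, x + w ≠ 0 ∧ x * w - y ^ 2 ≠ 0 ∧
      x ^ 2 + y ^ 2 = -a ∧ y * (x + w) = -b ∧ y ^ 2 + w ^ 2 = -c := by
  have hc : c < 0 := by
    by_contra! hc
    nlinarith [sq_nonneg b, mul_nonpos_of_nonpos_of_nonneg ha.le hc]
  obtain ⟨d, hd_pos, hd_sq⟩ : ∃ d : ℝ, 0 < d ∧ d ^ 2 = a * c - b ^ 2 :=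
    ⟨√(a * c - b ^ 2), Real.sqrt_pos.2 hd, Real.sq_sqrt hd.le⟩
  obtain ⟨τ, hτ_pos, hτ_sq⟩ : ∃ τ : ℝ, 0 < τ ∧ τ ^ 2 = 2 * d - a - c :=
    ⟨√(2 * d - a - c), Real.sqrt_pos.2 (by linarith), Real.sq_sqrt (by linarith)⟩
  have h_trace : (d - a) / τ + (d - c) / τ = τ := by
    field_simp
    linear_combination -hτ_sq
  have h_det : (d - a) / τ * ((d - c) / τ) - (-b / τ) ^ 2 = d := by
    field_simp
    linear_combination -hd_sq - d * hτ_sq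
  refine ⟨(d - a) / τ, -b / τ, (d - c) / τ, by rw [h_trace]; exact hτ_pos.ne',
    by rw [h_det]; exact hd_pos.ne', ?_, ?_, ?_⟩
  · field_simp
    linear_combination hd_sq + a * hτ_sq
  · rw [h_trace, div_mul_cancel₀ _ hτ_pos.ne']
  · field_simp
    linear_combination hd_sq + c * hτ_sq

lemma det_blockForm (a b c : ℂ) : (blockForm a b c).det = a * c - b ^ 2 := by
  simp [blockForm, Matrix.det_fin_three]
  ring

lemma transpose_blockForm_mul_mul_blockForm (x y w : ℂ) :
    (blockForm x y w)ᵀ * blockForm (-1) 0 (-1) * blockForm x y w =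
      blockForm (-(x ^ 2 + y ^ 2)) (-(y * (x + w))) (-(y ^ 2 + w ^ 2)) := by
  ext i j
  fin_cases i <;> fin_cases j <;> simp [blockForm, Matrix.mul_apply, Fin.sum_univ_three] <;> ring

lemma blockForm_mul_complexify_axisRot_comm {x y w z : ℂ} (hy : z.im * y = 0)
    (hxw : z.im * (x - w) = 0) :
    blockForm x y w * complexify (axisRot z) = complexify (axisRot z) * blockForm x y w := by
  rw [complexify_axisRot]
  ext i j
  fin_cases i <;> fin_cases j <;> simp [blockForm, Matrix.mul_apply, Fin.sum_univ_three] <;>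
    grind

end SquareRoots

namespace ConicBundleAction.IsBlockForm

variable {X : RealConicBundle} {m : ℕ} {α : ConicBundleAction X m} {g : (ZMod m)ˣ}
  {B : BaseC → Matrix (Fin 3) (Fin 3) ℂ} {a b c e : BaseC → ℂ}

lemma im_mul_eq_zero (H : α.IsBlockForm g B a b c e) (h_zero : ∀ k, α.σ k 0 = 0) (j : ℕ) :
    (stdRoot m ^ j).im * b 0 = 0 ∧ (stdRoot m ^ j).im * (a 0 - c 0) = 0 := by
  by_cases h_im : (stdRoot m ^ j).im = 0
  · simp [h_im]
  · have hinv := (H.invariant h_zero j).self_of_nhds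
    rw [h_zero, fibRot_eq_complexify] at hinv
    obtain ⟨hb, hac⟩ := eq_of_axisRot_invariant (norm_stdRoot_pow m j) h_im hinv
    simp [hb, hac]

/-- The square root of a symmetric matrix commutes with everything the matrix commutes with. -/
lemma exists_sqrt (H : α.IsBlockForm g B a b c e) (h_zero : ∀ k, α.σ k 0 = 0)
    (ha : (a 0).re < 0) (hd : 0 < (a 0).re * (c 0).re - (b 0).re ^ 2) :
    ∃ L : Matrix (Fin 3) (Fin 3) ℂ, IsRealMatrixGerm (fun _ : BaseC => L) ∧ L.det ≠ 0 ∧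
      (∀ j, L * fibRot m j = fibRot m j * L) ∧
      Lᵀ * blockForm (-1) 0 (-1) * L = blockForm (a 0) (b 0) (c 0) := by
  obtain ⟨x, y, w, h_trace, h_det, hxx, hxy, hww⟩ := exists_sqrt_of_neg ha hd
  have ha_eq : (x ^ 2 + y ^ 2 : ℂ) = -a 0 := by
    rw [← H.isRealGerm_a.ofReal_re]
    exact_mod_cast hxx
  have hb_eq : (y * (x + w) : ℂ) = -b 0 := by
    rw [← H.isRealGerm_b.ofReal_re]
    exact_mod_cast hxy
  have hc_eq : (y ^ 2 + w ^ 2 : ℂ) = -c 0 := by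
    rw [← H.isRealGerm_c.ofReal_re]
    exact_mod_cast hww
  have h_trace' : (x + w : ℂ) ≠ 0 := by exact_mod_cast h_trace
  refine ⟨blockForm x y w, isRealMatrixGerm_blockForm (.ofReal x) (.ofReal y) (.ofReal w), ?_,
    fun j => ?_, ?_⟩
  · rw [det_blockForm]
    exact_mod_cast h_det
  · obtain ⟨h_im_b, h_im_ac⟩ := H.im_mul_eq_zero h_zero j
    rw [fibRot_eq_complexify]
    exact blockForm_mul_complexify_axisRot_comm
      (mul_right_cancel₀ h_trace' (by linear_combination (stdRoot m ^ j).im * hb_eq - h_im_b))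
      (mul_right_cancel₀ h_trace'
        (by linear_combination (stdRoot m ^ j).im * (ha_eq - hc_eq) - h_im_ac))
  · rw [transpose_blockForm_mul_mul_blockForm, ha_eq, hb_eq, hc_eq, neg_neg, neg_neg, neg_neg]

lemma equivariantlyEquivalent_smooth [NeZero m] (H : α.IsBlockForm g B a b c e)
    (h_zero : ∀ k, α.σ k 0 = 0) (ha : (a 0).re < 0)
    (hd : 0 < (a 0).re * (c 0).re - (b 0).re ^ 2) {φ : BaseC → BaseC} (hφ : IsCoord φ) {n : ℕ}
    (hφ_rot : ∀ᶠ s in 𝓝 0, φ (α.σ g s) = baseRot m n 1 *ᵥ φ s) :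
    EquivariantlyEquivalent α (g : ZMod m) n normalForm₁ 1 := by
  obtain ⟨L, hL, hL_det, hL_comm, hL_eq⟩ := H.exists_sqrt h_zero ha hd
  set F : BaseC → Matrix (Fin 3) (Fin 3) ℂ := fun s => blockForm (a s) (b s) (c s)
  change _ = F 0 at hL_eq
  have hF : IsRealMatrixGerm F :=
    isRealMatrixGerm_blockForm H.isRealGerm_a H.isRealGerm_b H.isRealGerm_c
  have hF₀ : IsRealMatrixGerm fun _ : BaseC => F 0 := fun i j =>
    .const (by simpa only [star_zero] using (hF i j).2.self_of_nhds.symm)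
  have hL_inv : IsRealMatrixGerm fun _ : BaseC => L⁻¹ := hL.inv hL_det
  have hK : IsRealMatrixGerm fun s => L⁻¹ᵀ * (F s - F 0) * L⁻¹ :=
    (hL_inv.transpose.mul fun i j => (hF i j).sub (hF₀ i j)).mul hL_inv
  refine equivariantlyEquivalent_of_germs h_zero hφ hφ_rot
    (H.toIsLinearFrame.mul hL hL_det fun j => .of_forall fun _ => hL_comm j) hK
    (.of_forall fun s => isSymm_transpose_mul_mul
      ((isSymm_blockForm _ _ _).sub (isSymm_blockForm _ _ _)) _)
    (fun i j => isBigO_norm_of_analyticAt (hK i j).1 (by simp)) ?_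
  filter_upwards [H.quadVal_eq, H.isRealGerm_e.eventually_ne H.e_ne_zero] with s hs he
  refine ⟨e s, he, fun v => ?_⟩
  rw [← hs]
  have hN : normalForm₁ (φ s) ((L * B s) *ᵥ v) = quadVal (F 0) (B s *ᵥ v) := by
    rw [← hL_eq, quadVal_transpose_mul_mul, Matrix.mulVec_mulVec, quadVal_blockForm, normalForm₁]
    ring
  rw [hN, quadVal_transpose_mul_mul, Matrix.mulVec_mulVec, Matrix.nonsing_inv_mul_cancel_left _ _
    hL_det.isUnit, quadVal_sub_left]
  ring

end ConicBundleAction.IsBlockForm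

section VanishesTwice

variable {E : Type*} [NormedAddCommGroup E] [NormedSpace ℂ E] {p : E}

lemma vanishesTwice_quadVal_blockForm {a b c : E → ℂ} {u : E → FibC} (ha : VanishesTwice a p)
    (hb : VanishesTwice b p) (hc : VanishesTwice c p) (hu : DifferentiableAt ℂ u p)
    (hu_two : u p 2 = 0) :
    VanishesTwice (fun x => quadVal (blockForm (a x) (b x) (c x)) (u x)) p := by
  have hu' (i : Fin 3) : DifferentiableAt ℂ (fun x => u x i) p := differentiableAt_pi.1 hu i
  refine ((((VanishesTwice.mul (f := fun x => u x 2) hu_two (hu' 2) hu_two (hu' 2)).add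
    (ha.mul_left ((hu' 0).mul (hu' 0)))).add
    (hb.mul_left (((hu' 0).mul (hu' 1)).const_mul 2))).add
    (hc.mul_left ((hu' 1).mul (hu' 1)))).congr (.of_forall fun x => ?_)
  simp only [quadVal_blockForm, Pi.mul_apply]
  ring

lemma vanishesTwice_of_invariant {n : Type*} [Fintype n] [DecidableEq n] {f : (n → ℂ) → ℂ}
    {σ : (n → ℂ) → n → ℂ} {N : Matrix n n ℝ} (hf : f 0 = 0) (hf' : DifferentiableAt ℂ f 0)
    (hσ : HasRealJacobian σ N) (hσ_zero : σ 0 = 0) (h : ∀ᶠ s in 𝓝 0, f (σ s) = f s)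
    (hdet : (N - 1).det ≠ 0) : VanishesTwice f 0 := by
  have h_fderiv (v : n → ℂ) : fderiv ℂ f 0 (complexify N *ᵥ v) = fderiv ℂ f 0 v := by
    have h_comp := HasFDerivAt.comp (0 : n → ℂ) (g := f) (by rw [hσ_zero]; exact hf'.hasFDerivAt) hσ
    exact DFunLike.congr_fun (h_comp.unique (hf'.hasFDerivAt.congr_of_eventuallyEq h)) v
  refine ⟨hf, hf'.hasFDerivAt.congr_fderiv (ContinuousLinearMap.ext fun v => ?_)⟩
  obtain ⟨w, rfl⟩ : ∃ w, complexify (N - 1) *ᵥ w = v := by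
    have h_det : (complexify (N - 1)).det ≠ 0 := by
      rw [det_complexify]
      exact_mod_cast hdet
    exact ⟨(complexify (N - 1))⁻¹ *ᵥ v, by
      rw [Matrix.mulVec_mulVec, Matrix.mul_nonsing_inv _ h_det.isUnit, Matrix.one_mulVec]⟩
  rw [map_sub, map_one, Matrix.sub_mulVec, Matrix.one_mulVec, map_sub, h_fderiv, sub_self]
  rfl

end VanishesTwice

section PlaneRotations

lemma det_ne_zero_of_mul_eq_planeRot_mul {K N : Matrix (Fin 2) (Fin 2) ℝ} {z : ℂ}
    (hz : z.im ≠ 0) (hK : K ≠ 0) (h : K * N = planeRot z * K) : K.det ≠ 0 := by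
  intro h_det
  obtain ⟨w, hw, hwK⟩ := Matrix.exists_vecMul_eq_zero_iff.2 h_det
  have hwzK : w ᵥ* planeRot z ᵥ* K = 0 := by
    rw [Matrix.vecMul_vecMul, ← h, ← Matrix.vecMul_vecMul, hwK, Matrix.zero_vecMul]
  have hw_norm : w 0 ^ 2 + w 1 ^ 2 ≠ 0 := fun h_norm => hw <| by
    ext i
    fin_cases i <;> simp <;> nlinarith [sq_nonneg (w 0), sq_nonneg (w 1)]
  refine hK (Matrix.ext fun i j => (?_ : ∀ i, K i j = 0) i)
  have h₁ : w 0 * K 0 j + w 1 * K 1 j = 0 := by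
    simpa [Matrix.vecMul, dotProduct, Fin.sum_univ_two] using congrFun hwK j
  have h₂ : (w 0 * z.re - w 1 * z.im) * K 0 j + (w 0 * z.im + w 1 * z.re) * K 1 j = 0 := by
    simpa [planeRot_apply, Matrix.vecMul, dotProduct, Fin.sum_univ_two, sub_eq_add_neg] using
      congrFun hwzK j
  have h₃ : w 0 * K 1 j - w 1 * K 0 j = 0 :=
    mul_left_cancel₀ hz (by linear_combination h₂ - z.re * h₁)
  exact Fin.forall_fin_two.2
    ⟨(mul_eq_zero_iff_left hw_norm).1 (by linear_combination w 0 * h₁ - w 1 * h₃),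
      (mul_eq_zero_iff_left hw_norm).1 (by linear_combination w 1 * h₁ + w 0 * h₃)⟩

/-- The harmonic part `p (x² - y²) + 2 q x y` of the binary form `a x² + 2 b x y + c y²`, encoded as
the vector `(p, q)`. -/
noncomputable def harmonicPart (a b c : ℂ) : BaseC := ![(a - c) / 2, b]

/-- A binary form is the sum of a multiple of `x² + y²` and a harmonic form, on which rotations act
with twice the angle. -/
lemma planeRot_sq_mulVec_of_axisRot_invariant {z a b c a' b' c' : ℂ} (hz : ‖z‖ = 1)
    (h : (complexify (axisRot z))ᵀ * blockForm a b c * complexify (axisRot z) =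
      blockForm a' b' c') :
    a + c = a' + c' ∧
      harmonicPart a b c = complexify (planeRot (z ^ 2)) *ᵥ harmonicPart a' b' c' := by
  obtain ⟨rfl, rfl, rfl⟩ := transpose_axisRot_mul_blockForm_mul_axisRot h
  have hpq := ofReal_re_sq_add_im_sq hz
  refine ⟨by linear_combination -(a + c) * hpq, ?_⟩
  ext i
  fin_cases i <;>
    simp [planeRot_apply, complexify_apply, Matrix.mulVec, dotProduct, harmonicPart, sq]
  · linear_combination -(a - c) / 2 * (z.re ^ 2 + z.im ^ 2 + 1) * hpq
  · linear_combination -b * (z.re ^ 2 + z.im ^ 2 + 1) * hpq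

end PlaneRotations

namespace ConicBundleAction.IsBlockForm

variable {X : RealConicBundle} {m : ℕ} {α : ConicBundleAction X m} {g : (ZMod m)ˣ}
  {B : BaseC → Matrix (Fin 3) (Fin 3) ℂ} {a b c e : BaseC → ℂ}

lemma mem_sing (H : α.IsBlockForm g B a b c e) (ha : VanishesTwice a 0) (hb : VanishesTwice b 0)
    (hc : VanishesTwice c 0) {v : FibC} (hv : v ≠ 0) (hv_two : v 2 = 0) :
    ((B 0)⁻¹ *ᵥ v, 0) ∈ X.sing := by
  have h_cancel : B 0 *ᵥ ((B 0)⁻¹ *ᵥ v) = v := by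
    rw [Matrix.mulVec_mulVec, Matrix.mul_nonsing_inv _ H.det_ne_zero.isUnit, Matrix.one_mulVec]
  set p : FibC × BaseC := ((B 0)⁻¹ *ᵥ v, 0)
  have h_snd {f : BaseC → ℂ} (hf : DifferentiableAt ℂ f 0) :
      DifferentiableAt ℂ (fun x : FibC × BaseC => f x.2) p :=
    DifferentiableAt.comp (g := f) p hf differentiableAt_snd
  have h_coords : DifferentiableAt ℂ (fun x : FibC × BaseC => B x.2 *ᵥ x.1) p :=
    differentiableAt_pi.2 fun i => DifferentiableAt.fun_sum (u := Finset.univ)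
      (A := fun k (x : FibC × BaseC) => B x.2 i k * x.1 k) fun k _ =>
      (h_snd (H.isRealMatrixGerm i k).1.differentiableAt).fun_mul
        (differentiableAt_pi.1 differentiableAt_fst k)
  have h_coeff {f : BaseC → ℂ} (hf : VanishesTwice f 0) :
      VanishesTwice (fun x : FibC × BaseC => f x.2) p :=
    VanishesTwice.comp (u := Prod.snd) hf differentiableAt_snd
  have h_form := vanishesTwice_quadVal_blockForm (h_coeff ha) (h_coeff hb) (h_coeff hc) h_coords
    ((congrFun h_cancel 2).trans hv_two)
  have h_eqn : X.eqn =ᶠ[𝓝 p] fun x => (e x.2)⁻¹ *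
      quadVal (blockForm (a x.2) (b x.2) (c x.2)) (B x.2 *ᵥ x.1) := by
    filter_upwards [continuous_snd.tendsto p |>.eventually H.quadVal_eq, continuous_snd.tendsto p
      |>.eventually (H.isRealGerm_e.eventually_ne H.e_ne_zero)] with x hx he
    rw [hx, inv_mul_cancel_left₀ he, RealConicBundle.eqn]
  have h_vanish : VanishesTwice X.eqn p :=
    (h_form.mul_left (h_snd (H.isRealGerm_e.inv H.e_ne_zero).1.differentiableAt)).congr h_eqn
  refine ⟨⟨fun h => hv ?_, X.zero_mem, h_vanish.eq_zero⟩, h_vanish.hasFDerivAt.fderiv⟩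
  rw [← h_cancel, show (B 0)⁻¹ *ᵥ v = 0 from h, Matrix.mulVec_zero]

lemma not_onlyIsolatedPts_sing (H : α.IsBlockForm g B a b c e) (ha : VanishesTwice a 0)
    (hb : VanishesTwice b 0) (hc : VanishesTwice c 0) : ¬ OnlyIsolatedPts X.sing := by
  intro h_iso
  have h_mem (t : ℂ) : ((B 0)⁻¹ *ᵥ ![1, t, 0], 0) ∈ X.sing :=
    H.mem_sing ha hb hc (fun h => one_ne_zero (congrFun h 0)) rfl
  obtain ⟨U, hU, hU_iso⟩ := h_iso _ (h_mem 0)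
  have h_cont : Continuous fun t : ℂ => (((B 0)⁻¹ *ᵥ ![1, t, 0], 0) : FibC × BaseC) := by
    fun_prop
  obtain ⟨t, ht_U, ht⟩ := (((h_cont.tendsto 0).mono_left nhdsWithin_le_nhds).eventually hU |>.and
    self_mem_nhdsWithin).exists (f := 𝓝[≠] 0)
  obtain ⟨d, hd⟩ := (hU_iso _ ⟨ht_U, h_mem t⟩).2
  rw [← Matrix.mulVec_smul] at hd
  have h_eq := Matrix.mulVec_injective_of_isUnit
    ((Matrix.isUnit_nonsing_inv_iff).2 ((Matrix.isUnit_iff_isUnit_det _).2 H.det_ne_zero.isUnit)) hd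
  exact ht (by simpa using congrFun h_eq 1)

lemma eventually_trace_and_harmonicPart (H : α.IsBlockForm g B a b c e)
    (h_zero : ∀ k, α.σ k 0 = 0) :
    ∀ᶠ s in 𝓝 0, a (α.σ g s) + c (α.σ g s) = a s + c s ∧
      harmonicPart (a (α.σ g s)) (b (α.σ g s)) (c (α.σ g s)) =
        baseRot m 2 1 *ᵥ harmonicPart (a s) (b s) (c s) := by
  have h_inv := H.invariant h_zero 1
  simp only [Nat.cast_one, one_mul] at h_inv
  filter_upwards [h_inv] with s hs
  rw [fibRot_eq_complexify] at hs
  rw [baseRot_eq_complexify, mul_comm 2 1, pow_mul]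
  exact planeRot_sq_mulVec_of_axisRot_invariant (norm_stdRoot_pow m 1) hs

lemma vanishesTwice_trace (H : α.IsBlockForm g B a b c e) (h_zero : ∀ k, α.σ k 0 = 0)
    {N : Matrix (Fin 2) (Fin 2) ℝ} (hN : HasRealJacobian (α.σ g) N) (hN_det : (N - 1).det ≠ 0)
    (ha : a 0 = 0) (hc : c 0 = 0) : VanishesTwice (fun s => a s + c s) 0 :=
  vanishesTwice_of_invariant (by rw [ha, hc, add_zero])
    (H.isRealGerm_a.add H.isRealGerm_c).1.differentiableAt hN (h_zero _)
    ((H.eventually_trace_and_harmonicPart h_zero).mono fun _ hs => hs.1) hN_det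

lemma isCoord_harmonicPart [NeZero m] (H : α.IsBlockForm g B a b c e) (h_zero : ∀ k, α.σ k 0 = 0)
    (hm : ¬ m ∣ 4) (h_sing : OnlyIsolatedPts X.sing) {N : Matrix (Fin 2) (Fin 2) ℝ}
    (hN : HasRealJacobian (α.σ g) N) (hN_det : (N - 1).det ≠ 0)
    (ha : a 0 = 0) (hb : b 0 = 0) (hc : c 0 = 0) :
    IsCoord fun s => harmonicPart (a s) (b s) (c s) := by
  have h_diff : IsRealGerm fun s => (a s - c s) / 2 := by
    simpa only [div_eq_mul_inv] using
      (H.isRealGerm_a.sub H.isRealGerm_c).mul (.const (c := (2 : ℂ)⁻¹) (by simp))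
  have hD : IsRealGerm fun s => harmonicPart (a s) (b s) (c s) :=
    IsRealGerm.pi_iff.2 (Fin.forall_fin_two.2 ⟨h_diff, H.isRealGerm_b⟩)
  obtain ⟨K, hK⟩ := hD.exists_hasRealJacobian
  have hK_comm : K * N = planeRot (stdRoot m ^ (2 * 1)) * K := by
    refine (hK.comp hN (h_zero _)).unique ((hK.mulVec _).congr ?_)
    filter_upwards [H.eventually_trace_and_harmonicPart h_zero] with s hs
    rw [hs.2, baseRot_eq_complexify]
  have hK_ne : K ≠ 0 := by
    rintro rfl
    have hT := H.vanishesTwice_trace h_zero hN hN_det ha hc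
    have hD_vanish (i : Fin 2) : VanishesTwice (fun s => harmonicPart (a s) (b s) (c s) i) 0 := by
      refine ⟨by fin_cases i <;> simp [harmonicPart, ha, hb, hc],
        (hasFDerivAt_pi'.1 hK i).congr_fderiv (ContinuousLinearMap.ext fun v => ?_)⟩
      simp
    have ha' : VanishesTwice a 0 :=
      ((hT.mul_left (h := fun _ => 1 / 2) (differentiableAt_const _)).add (hD_vanish 0)).congr
        (.of_forall fun s => by simp [harmonicPart]; ring)
    have hc' : VanishesTwice c 0 :=
      (hT.add (ha'.mul_left (h := fun _ => -1) (differentiableAt_const _))).congr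
        (.of_forall fun s => by simp)
    exact H.not_onlyIsolatedPts_sing ha' (hD_vanish 1) hc' h_sing
  have h_im : (stdRoot m ^ (2 * 1)).im ≠ 0 := fun h =>
    hm (dvd_two_mul_of_im_stdRoot_pow_eq_zero h)
  exact ⟨hD, by simp [harmonicPart, ha, hb, hc], K,
    det_ne_zero_of_mul_eq_planeRot_mul h_im hK_ne hK_comm, hK⟩

lemma equivariantlyEquivalent_double_line [NeZero m] (H : α.IsBlockForm g B a b c e)
    (h_zero : ∀ k, α.σ k 0 = 0) (hm : ¬ m ∣ 4) (h_sing : OnlyIsolatedPts X.sing)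
    {N : Matrix (Fin 2) (Fin 2) ℝ} (hN : HasRealJacobian (α.σ g) N) (hN_det : (N - 1).det ≠ 0)
    (ha : a 0 = 0) (hb : b 0 = 0) (hc : c 0 = 0) :
    EquivariantlyEquivalent α (g : ZMod m) 2 normalForm₂ 2 := by
  have hT := H.vanishesTwice_trace h_zero hN hN_det ha hc
  set E : Matrix (Fin 3) (Fin 3) ℝ := Matrix.diagonal ![1, 1, 0]
  have hE (u : FibC) : quadVal (complexify E) u = u 0 ^ 2 + u 1 ^ 2 := by
    simp [E, quadVal, complexify_apply, Matrix.mulVec, Matrix.diagonal_apply, dotProduct,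
      Fin.sum_univ_three, sq]
  have h_half : IsRealGerm fun s => 1 / 2 * (a s + c s) :=
    .mul (.const (by simp)) (H.isRealGerm_a.add H.isRealGerm_c)
  have hK : IsRealMatrixGerm fun s => (1 / 2 * (a s + c s)) • complexify E :=
    IsRealMatrixGerm.smul h_half (.complexify E)
  refine equivariantlyEquivalent_of_germs h_zero
    (H.isCoord_harmonicPart h_zero hm h_sing hN hN_det ha hb hc)
    ((H.eventually_trace_and_harmonicPart h_zero).mono fun _ hs => hs.2) H.toIsLinearFrame hK
    (.of_forall fun s => ((Matrix.isSymm_diagonal _).map _).smul _) (fun i j => ?_) ?_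
  · exact (((hT.mul_left (differentiableAt_const (1 / 2))).mul_left
      (differentiableAt_const (complexify E i j))).congr
      (.of_forall fun s => mul_comm _ _)).isBigO_norm_sq (hK i j).1
  · filter_upwards [H.quadVal_eq, H.isRealGerm_e.eventually_ne H.e_ne_zero] with s hs he
    refine ⟨e s, he, fun v => ?_⟩
    rw [← hs, quadVal_blockForm, normalForm₂, quadVal_smul_left, hE]
    simp only [harmonicPart, Matrix.cons_val_zero, Matrix.cons_val_one]
    ring

end ConicBundleAction.IsBlockForm

theorem mainTheorem7 (m : ℕ) (hm : 2 ≤ m) (X : RealConicBundle) (α : ConicBundleAction X m)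
    (h_zero : ∀ k, α.σ k 0 = 0)
    (h_sing : OnlyIsolatedPts X.sing)
    (h_real : ∃ p ∈ X.total, p.2 = 0 ∧ IsRealPt p)
    (h_fix : ∀ k : ZMod m, k ≠ 0 →
      OnlyIsolatedPts (α.fixedPts k) ∧ ∀ p ∈ α.fixedPts k, ¬ IsRealPt p) :
    ∃ g : (ZMod m)ˣ,
      (∃ b : ℕ, Nat.Coprime b m ∧ EquivariantlyEquivalent α (g : ZMod m) b normalForm₁ 1) ∨
      (Odd m ∧ EquivariantlyEquivalent α (g : ZMod m) 2 normalForm₂ 2) := by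
  have : NeZero m := ⟨by lia⟩
  have h_real_fix (k : ZMod m) (hk : k ≠ 0) := (h_fix k hk).2
  obtain ⟨g, B₀, hB₀⟩ := α.exists_isLinearFrame h_zero h_real h_real_fix
  obtain ⟨B, a, b, c, e, H⟩ := hB₀.exists_isBlockForm hm h_zero h_real_fix
  obtain ⟨ρ, hρ⟩ := α.exists_isTangentRep h_zero
  have hρ_det (k : ZMod m) (hk : k ≠ 0) : (ρ (.ofAdd k) - 1).det ≠ 0 :=
    hρ.det_sub_one_ne_zero h_zero <| H.eventually_ne_self h_zero
      (H.discr_pos_of_even h_zero h_real_fix) (fun k hk => (h_fix k hk).1) hk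
  have : Fact (1 < m) := ⟨hm⟩
  refine ⟨g, ?_⟩
  rcases H.central_fibre h_zero hm h_real h_real_fix with ⟨ha, hd⟩ | ⟨hm_odd, ha, hb, hc⟩
  · have hρ_inj := injective_of_det_sub_one_ne_zero (ρ := ρ) fun k hk => hρ_det k.toAdd hk
    obtain ⟨n, φ, hn, hφ, hφ_rot⟩ := hρ.exists_base_rotation h_zero hρ_inj g (hρ_det g g.ne_zero)
    exact Or.inl ⟨n, hn, H.equivariantlyEquivalent_smooth h_zero ha hd hφ hφ_rot⟩
  · have hm_four : ¬ m ∣ 4 := fun h =>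
      Nat.ne_of_gt hm ((hm_odd.coprime_two_right.pow_right 2).eq_one_of_dvd h)
    exact Or.inr ⟨hm_odd, H.equivariantlyEquivalent_double_line h_zero hm_four h_sing (hρ g)
      (hρ_det g g.ne_zero) ha hb hc⟩
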